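/- A Boolean relation $R\subseteq\{0,1\}^r$ is an OR-conj (respectively NAND-conj) relation if it is defined by a conjunction of pins ($x_i=0$ or $x_i=1$) and ORs (respectively NANDs) of variables, of any arity. Such a formula is normalized if no pinned variable occurs in an OR (NAND), the arguments of each OR (NAND) are distinct, each OR (NAND) has at least two arguments, and the argument set of no OR (NAND) is contained in that of another; a formula that pins some variable to both values is moreover required to contain no OR (NAND), so that the empty relation has width $0$. The width of $R$ is the largest number of arguments of an OR (NAND) in a normalized formula defining $R$, and $0$ if there are none. A hypergraph $H=(V,E)$ has a finite vertex set $V$ and a set $E$ of non-empty subsets of $V$; its width is $\max_{e\in E}|e|$ ($0$ if $E=\emptyset$), its degree is the largest number of hyper-edges containing a common vertex, and $S\subseteq V$ is independent if $e\not\subseteq S$ for all $e\in E$. Let $\#w\text{-HIS}_d$ be the problem of counting the independent sets of a given hypergraph of width $w$ and degree at most $d$. For a finite set $\Gamma$ of named Boolean relations, an instance of $\#\mathrm{CSP}_d(\Gamma)$ is a finite set $V$ of variables and a set of constraints $Q(v_1,\dots,v_k)$ with $Q\in\Gamma$ of arity $k$ and $v_1,\dots,v_k\in V$ (not necessarily distinct),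 such that every variable appears at most $d$ times, counted with multiplicity, among the constraints; the task is to count the assignments $\sigma\colon V\to\{0,1\}$ that satisfy all constraints. Let $R_{\mathrm{zero}}=\{0\}$ and $R_{\mathrm{one}}=\{1\}$ be the two singleton unary relations. A randomized approximation scheme for a counting problem $f$ takes an instance $x$ of $f$ and an error bound $\epsilon\in(0,1)$ (given by a finite binary expansion) and produces a random natural number $Y$ with $\Pr\bigl(e^{-\epsilon}f(x)\le Y\le e^{\epsilon}f(x)\bigr)\ge\frac34$. An approximation-preserving (AP) reduction from $f$ to $g$ is a probabilistic oracle Turing machine $M$ that takes such pairs $(x,\epsilon)$ as input and satisfies: (i) every oracle call made by $M$ is of the form $(y,\delta)$, where $y$ is an instance of $g$ and $0<\delta<1$ satisfies $\delta^{-1}\le\mathrm{poly}(|x|,\epsilon^{-1})$; (ii) $M$ is a randomized approximation scheme for $f$ whenever the oracle is a randomized approximation scheme for $g$; (iii) the running time of $M$ is polynomial in $|x|$ and $\epsilon^{-1}$. **Proposition.** Let $R$ be an OR-conj or NAND-conj relation of width $w$, and let $d\ge 2$. Then there is an AP-reduction from $\#w\text{-HIS}_d$ to $\#\mathrm{CSP}_d(\{R\}\cup\{R_{\mathrm{zero}},R_{\mathrm{one}}\})$.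 -/

import Mathlib

/-! ### Boolean relations, OR-conj and NAND-conj relations, width -/

/-- A Boolean relation `R ⊆ {0,1}^r`. -/
structure BoolRel where
  arity : ℕ
  rel : Set (Fin arity → Bool)

/-- The unary relation `{0}`. -/
def BoolRel.zero : BoolRel := ⟨1, {a | a 0 = false}⟩

/-- The unary relation `{1}`. -/
def BoolRel.one : BoolRel := ⟨1, {a | a 0 = true}⟩

/-- A conjunction of pins `x_i = c` and of clauses over variables `x_0, …, x_{r-1}`; a clause is
the list of its arguments. The same syntax serves for ORs and for NANDs. -/
structure ConjFormula (r : ℕ) where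
  pins : List (Fin r × Bool)
  clauses : List (List (Fin r))

namespace ConjFormula

variable {r : ℕ}

/-- Truth of the formula when every clause is read as an OR of its arguments. -/
def HoldsOR (φ : ConjFormula r) (a : Fin r → Bool) : Prop :=
  (∀ p ∈ φ.pins, a p.1 = p.2) ∧ ∀ c ∈ φ.clauses, ∃ i ∈ c, a i = true

/-- Truth of the formula when every clause is read as a NAND of its arguments. -/
def HoldsNAND (φ : ConjFormula r) (a : Fin r → Bool) : Prop :=
  (∀ p ∈ φ.pins, a p.1 = p.2) ∧ ∀ c ∈ φ.clauses, ¬ ∀ i ∈ c, a i = true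

/-- Normalized formulae. The last field only concerns the empty relation: a formula that pins some
variable to both values has no clauses. (Without it the normalized formula, and hence the width, of
the empty relation would be ambiguous.) -/
structure Normalized (φ : ConjFormula r) : Prop where
  pinned_not_mem : ∀ p ∈ φ.pins, ∀ c ∈ φ.clauses, p.1 ∉ c
  nodup : ∀ c ∈ φ.clauses, c.Nodup
  two_le_length : ∀ c ∈ φ.clauses, 2 ≤ c.length
  incomparable : φ.clauses.Pairwise fun c c' => ¬ c ⊆ c' ∧ ¬ c' ⊆ c
  consistent : (∃ i, (i, false) ∈ φ.pins ∧ (i, true) ∈ φ.pins) → φ.clauses = []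

/-- The greatest number of arguments of a clause (`0` if there are no clauses). -/
def width (φ : ConjFormula r) : ℕ := (φ.clauses.map List.length).foldr max 0

end ConjFormula

/-- `R` is an OR-conj relation of width `w`. -/
def BoolRel.IsORConjOfWidth (R : BoolRel) (w : ℕ) : Prop :=
  ∃ φ : ConjFormula R.arity, φ.Normalized ∧ (∀ a, a ∈ R.rel ↔ φ.HoldsOR a) ∧ φ.width = w

/-- `R` is a NAND-conj relation of width `w`. -/
def BoolRel.IsNANDConjOfWidth (R : BoolRel) (w : ℕ) : Prop :=
  ∃ φ : ConjFormula R.arity, φ.Normalized ∧ (∀ a, a ∈ R.rel ↔ φ.HoldsNAND a) ∧ φ.width = w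

/-! ### Hypergraphs -/

/-- A finite hypergraph with vertex set all of `V`: a set of non-empty hyper-edges. -/
@[ext]
structure FinHypergraph (V : Type) where
  edges : Finset (Finset V)
  nonempty : ∀ e ∈ edges, e.Nonempty

namespace FinHypergraph

variable {V : Type} [Fintype V] [DecidableEq V]

/-- The number of hyper-edges containing `v`. -/
def vertexDegree (H : FinHypergraph V) (v : V) : ℕ := (H.edges.filter fun e => v ∈ e).card

/-- The maximum degree of a vertex. -/
def degree (H : FinHypergraph V) : ℕ := Finset.univ.sup H.vertexDegree

/-- The size of a largest hyper-edge. -/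
def width {V : Type} (H : FinHypergraph V) : ℕ := H.edges.sup Finset.card

/-- `S` contains no hyper-edge. -/
def IsIndependent {V : Type} (H : FinHypergraph V) (S : Finset V) : Prop :=
  ∀ e ∈ H.edges, ¬ e ⊆ S

end FinHypergraph

/-! ### Boolean constraint satisfaction -/

/-- A finite constraint language, i.e. relations named `0, …, m - 1`. -/
abbrev ConstraintLanguage := List BoolRel

/-- The language of the two pins. -/
def pinLanguage : ConstraintLanguage := [BoolRel.zero, BoolRel.one]

/-- The constraints `R(v̄)` over `Γ` with variables in `V`. -/
abbrev Constraint (Γ : ConstraintLanguage) (V : Type) : Type :=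
  Σ i : Fin Γ.length, (Fin (Γ.get i).arity → V)

/-- A CSP instance over `Γ` with variable set `V`: a set of constraints. -/
@[ext]
structure CSPInstance (Γ : ConstraintLanguage) (V : Type) where
  constraints : Finset (Constraint Γ V)

namespace CSPInstance

variable {Γ : ConstraintLanguage} {V : Type}

/-- The assignment `σ` satisfies every constraint. -/
def Satisfies (I : CSPInstance Γ V) (σ : V → Bool) : Prop :=
  ∀ c ∈ I.constraints, (fun j => σ (c.2 j)) ∈ (Γ.get c.1).rel

/-- The number of times that `v` appears among the constraints, with multiplicity in scopes. -/
def occurrences [DecidableEq V] (I : CSPInstance Γ V) (v : V) : ℕ :=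
  ∑ c ∈ I.constraints, (Finset.univ.filter fun j => c.2 j = v).card

/-- The greatest number of times that any variable appears. -/
def degree [Fintype V] [DecidableEq V] (I : CSPInstance Γ V) : ℕ :=
  Finset.univ.sup I.occurrences

end CSPInstance

/-! ### Counting problems over binary strings -/

/-- A counting problem: a class of instances, the binary strings that encode each of them
(an instance may have several encodings, a string encodes at most one instance), and the number to
be computed. Strings that encode no instance are not inputs of the problem. -/
structure CountingProblem where
  Inst : Type
  Encodes : List Bool → Inst → Prop
  encodes_unique : ∀ s I J, Encodes s I → Encodes s J → I = J
  exists_encoding : ∀ I, ∃ s, Encodes s I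
  count : Inst → ℕ

/-- The number `k` in unary, `1^k 0`. -/
def unary (k : ℕ) : List Bool := List.replicate k true ++ [false]

theorem unary_append_inj : ∀ {a b : ℕ} {u v : List Bool},
    unary a ++ u = unary b ++ v → a = b ∧ u = v
  | 0, 0, u, v, h => by simpa [unary] using h
  | 0, b + 1, u, v, h => by simp [unary, List.replicate_succ] at h
  | a + 1, 0, u, v, h => by simp [unary, List.replicate_succ] at h
  | a + 1, b + 1, u, v, h => by
    have h' : unary a ++ u = unary b ++ v := by
      simpa [unary, List.replicate_succ] using h
    obtain ⟨h1, h2⟩ := unary_append_inj h'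
    exact ⟨by omega, h2⟩

theorem flatMap_inj {α : Type} (c : α → List Bool) (hne : ∀ a, c a ≠ [])
    (hc : ∀ a b u v, c a ++ u = c b ++ v → a = b ∧ u = v) :
    ∀ L M : List α, L.flatMap c = M.flatMap c → L = M
  | [], [], _ => rfl
  | [], b :: M, h => by simp [hne] at h
  | a :: L, [], h => by simp [hne] at h
  | a :: L, b :: M, h => by
    simp only [List.flatMap_cons] at h
    obtain ⟨h1, h2⟩ := hc _ _ _ _ h
    rw [h1, flatMap_inj c hne hc L M h2]

/-- A hyper-edge as a row of the incidence matrix, preceded by a `1`. -/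
def edgeCode {n : ℕ} (e : Finset (Fin n)) : List Bool :=
  true :: List.ofFn fun i : Fin n => decide (i ∈ e)

/-- The number of vertices in unary, followed by the listed hyper-edges. -/
def hypergraphCode (n : ℕ) (L : List (Finset (Fin n))) : List Bool :=
  unary n ++ L.flatMap edgeCode

theorem edgeCode_append_inj {n : ℕ} (e f : Finset (Fin n)) (u v : List Bool)
    (h : edgeCode e ++ u = edgeCode f ++ v) : e = f ∧ u = v := by
  obtain ⟨h1, h2⟩ := List.append_inj h (by simp [edgeCode])
  refine ⟨?_, h2⟩
  have h3 := List.ofFn_injective (List.cons.inj h1).2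
  ext i
  have := congrFun h3 i
  simpa using this

/-- The string `s` encodes `H`: it lists the hyper-edges of `H`, in any order and each once. -/
def FinHypergraph.EncodedBy (s : List Bool) {n : ℕ} (H : FinHypergraph (Fin n)) : Prop :=
  ∃ L : List (Finset (Fin n)), L.Nodup ∧ L.toFinset = H.edges ∧ s = hypergraphCode n L

/-- Counting the independent sets of hypergraphs of width `w` and degree at most `d`. -/
noncomputable def countHIS (w d : ℕ) : CountingProblem where
  Inst := {H : Σ n : ℕ, FinHypergraph (Fin n) // H.2.width = w ∧ H.2.degree ≤ d}
  Encodes s H := FinHypergraph.EncodedBy s H.1.2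
  encodes_unique := by
    rintro s ⟨⟨n, H⟩, hH⟩ ⟨⟨m, K⟩, hK⟩ ⟨L, -, hL, hs⟩ ⟨M, -, hM, hs'⟩
    obtain ⟨rfl, h⟩ := unary_append_inj (hs.symm.trans hs')
    have := flatMap_inj edgeCode (by simp [edgeCode]) edgeCode_append_inj L M h
    subst this
    have : H = K := FinHypergraph.ext (hL.symm.trans hM)
    subst this
    rfl
  exists_encoding H :=
    ⟨_, H.1.2.edges.toList, Finset.nodup_toList _, Finset.toList_toFinset _, rfl⟩
  count H := Nat.card {S : Finset (Fin H.1.1) // H.1.2.IsIndependent S}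

/-- A constraint: the name of the relation, then the variables of the scope, in unary. -/
def constraintCode {Γ : ConstraintLanguage} {n : ℕ} (c : Constraint Γ (Fin n)) : List Bool :=
  unary c.1 ++ (List.ofFn fun j => (c.2 j : ℕ)).flatMap unary

/-- The number of variables in unary, followed by the listed constraints. -/
def cspCode {Γ : ConstraintLanguage} (n : ℕ) (L : List (Constraint Γ (Fin n))) : List Bool :=
  unary n ++ L.flatMap constraintCode

theorem unary_ne_nil (k : ℕ) : unary k ≠ [] := by simp [unary]

theorem flatMap_unary_append_inj : ∀ (L M : List ℕ) (u v : List Bool), L.length = M.length →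
    L.flatMap unary ++ u = M.flatMap unary ++ v → L = M ∧ u = v
  | [], [], u, v, _, h => by simpa using h
  | [], b :: M, u, v, h, _ => by simp at h
  | a :: L, [], u, v, h, _ => by simp at h
  | a :: L, b :: M, u, v, hl, h => by
    simp only [List.flatMap_cons, List.append_assoc] at h
    obtain ⟨h1, h2⟩ := unary_append_inj h
    obtain ⟨h3, h4⟩ := flatMap_unary_append_inj L M u v (by simpa using hl) h2
    exact ⟨by rw [h1, h3], h4⟩

theorem constraintCode_append_inj {Γ : ConstraintLanguage} {n : ℕ}
    (c c' : Constraint Γ (Fin n)) (u v : List Bool)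
    (h : constraintCode c ++ u = constraintCode c' ++ v) : c = c' ∧ u = v := by
  obtain ⟨i, x⟩ := c
  obtain ⟨j, y⟩ := c'
  simp only [constraintCode, List.append_assoc] at h
  obtain ⟨h1, h2⟩ := unary_append_inj h
  obtain rfl : i = j := Fin.ext h1
  obtain ⟨h3, h4⟩ := flatMap_unary_append_inj _ _ _ _ (by simp) h2
  have h5 := List.ofFn_injective h3
  have : x = y := funext fun k => Fin.ext (congrFun h5 k)
  exact ⟨by rw [this], h4⟩

/-- The string `s` encodes `I`: it lists the constraints of `I`, in any order and each once. -/
def CSPInstance.EncodedBy {Γ : ConstraintLanguage} (s : List Bool) {n : ℕ}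
    (I : CSPInstance Γ (Fin n)) : Prop :=
  ∃ L : List (Constraint Γ (Fin n)), L.Nodup ∧ L.toFinset = I.constraints ∧ s = cspCode n L

/-- Counting the satisfying assignments of CSP instances over `Γ` of degree at most `d`. -/
noncomputable def countCSP (d : ℕ) (Γ : ConstraintLanguage) : CountingProblem where
  Inst := {I : Σ n : ℕ, CSPInstance Γ (Fin n) // I.2.degree ≤ d}
  Encodes s I := CSPInstance.EncodedBy s I.1.2
  encodes_unique := by
    rintro s ⟨⟨n, H⟩, hH⟩ ⟨⟨m, K⟩, hK⟩ ⟨L, -, hL, hs⟩ ⟨M, -, hM, hs'⟩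
    obtain ⟨rfl, h⟩ := unary_append_inj (hs.symm.trans hs')
    have := flatMap_inj constraintCode (by simp [constraintCode, unary_ne_nil])
      constraintCode_append_inj L M h
    subst this
    have : H = K := CSPInstance.ext (hL.symm.trans hM)
    subst this
    rfl
  exists_encoding I :=
    ⟨_, I.1.2.constraints.toList, Finset.nodup_toList _, Finset.toList_toFinset _, rfl⟩
  count I := Nat.card {σ : Fin I.1.1 → Bool // I.1.2.Satisfies σ}

/-! ### Randomized approximation schemes -/

noncomputable section

/-- An error bound is given by a finite binary expansion: `b₁ b₂ … bₘ` stands for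
`0.b₁b₂…bₘ`, a number in `[0, 1)`. -/
def errorValue : List Bool → ℝ
  | [] => 0
  | b :: l => ((b.toNat : ℝ) + errorValue l) / 2

/-- The number written in binary, least significant bit first. -/
def binaryValue (s : List Bool) : ℕ := Nat.ofDigits 2 (s.map Bool.toNat)

/-- With probability at least `3/4`, the random output `Y` (written in binary) satisfies
`e^{-ε} ≤ Y / v ≤ e^ε`, where for `v = 0` this means `Y = 0`. -/
def Approximates (μ : PMF (List Bool)) (ε : ℝ) (v : ℕ) : Prop :=
  3 / 4 ≤ μ.toOuterMeasure {s | Real.exp (-ε) * v ≤ binaryValue s ∧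
    (binaryValue s : ℝ) ≤ Real.exp ε * v}

/-- A randomized procedure mapping a pair of strings `(x, ε)` to a random output string, each call
with fresh randomness. -/
abbrev RandomizedMap := List Bool → List Bool → PMF (List Bool)

/-- `A` is a randomized approximation scheme for `f`. -/
def IsRAS (A : RandomizedMap) (f : CountingProblem) : Prop :=
  ∀ x I, f.Encodes x I → ∀ e, errorValue e ∈ Set.Ioo (0 : ℝ) 1 →
    Approximates (A x e) (errorValue e) (f.count I)

/-! ### Probabilistic oracle Turing machines -/

/-- The nonblank symbols in a half-tape; `none` is the blank. -/
def halfTapeString (l : Turing.ListBlank (Option Bool)) : List Bool :=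
  l.liftOn List.reduceOption (by
    rintro a b ⟨n, rfl⟩
    have : List.reduceOption (List.replicate n (none : Option Bool)) = [] := by
      simp [List.reduceOption]
    change a.reduceOption = (a ++ List.replicate n none).reduceOption
    rw [List.reduceOption_append, this, List.append_nil])

/-- The string written on a tape: its nonblank symbols from left to right. -/
def tapeString (T : Turing.Tape (Option Bool)) : List Bool :=
  (halfTapeString T.left).reverse ++ halfTapeString T.right₀

/-- A probabilistic oracle Turing machine with `k` two-way infinite tapes over the symbols
`0`, `1` and blank and with finitely many states. In each ordinary step it tosses a fair coin;
depending on the state, the scanned symbols and the coin, it changes its state, writes a symbol on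
each tape and moves each head by at most one cell. In the state `query` it consults the oracle in
one step. Tapes may play several of the designated roles. -/
structure OracleMachine where
  k : ℕ
  State : Type
  [fintypeState : Fintype State]
  [decEqState : DecidableEq State]
  start : State
  halt : State
  query : State
  resume : State
  inputTape : Fin k
  errorTape : Fin k
  input_ne_error : inputTape ≠ errorTape
  queryTape : Fin k
  queryErrorTape : Fin k
  query_ne_queryError : queryTape ≠ queryErrorTape
  answerTape : Fin k
  outputTape : Fin k
  step : State → (Fin k → Option Bool) → Bool →
    State × (Fin k → Option Bool × Option Turing.Dir)

attribute [instance] OracleMachine.fintypeState OracleMachine.decEqState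

namespace OracleMachine

/-- A configuration: the state and the tapes with their head positions. -/
structure Cfg (M : OracleMachine) where
  state : M.State
  tape : Fin M.k → Turing.Tape (Option Bool)

/-- Move the head by one cell, or not at all. -/
def moveHead : Option Turing.Dir → Turing.Tape (Option Bool) → Turing.Tape (Option Bool)
  | none, T => T
  | some D, T => T.move D

/-- A tape with the string `s`, scanned at its first symbol. -/
def stringTape (s : List Bool) : Turing.Tape (Option Bool) := Turing.Tape.mk₁ (s.map some)

variable (M : OracleMachine)

/-- The configuration at the start, on input `(x, ε)`. -/
def init (x e : List Bool) : M.Cfg where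
  state := M.start
  tape i := if i = M.inputTape then stringTape x
    else if i = M.errorTape then stringTape e else stringTape []

/-- The result of an ordinary step with coin `b`. -/
def stepWith (c : M.Cfg) (b : Bool) : M.Cfg :=
  let r := M.step c.state (fun i => (c.tape i).head) b
  ⟨r.1, fun i => moveHead (r.2 i).2 ((c.tape i).write (r.2 i).1)⟩

/-- The result of an oracle call that returned the string `s`. -/
def answerWith (c : M.Cfg) (s : List Bool) : M.Cfg :=
  ⟨M.resume, Function.update c.tape M.answerTape (stringTape s)⟩

/-- The string and the error bound of an oracle call made in configuration `c`. -/
def queryString (c : M.Cfg) : List Bool := tapeString (c.tape M.queryTape)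

/-- See `queryString`. -/
def queryError (c : M.Cfg) : List Bool := tapeString (c.tape M.queryErrorTape)

/-- The distribution of the next configuration. -/
def next (O : RandomizedMap) (c : M.Cfg) : PMF M.Cfg :=
  if c.state = M.halt then PMF.pure c
  else if c.state = M.query then (O (M.queryString c) (M.queryError c)).map (M.answerWith c)
  else (PMF.uniformOfFintype Bool).map (M.stepWith c)

/-- The distribution of the configuration after `t` steps, on input `(x, ε)`. -/
def run (O : RandomizedMap) (x e : List Bool) : ℕ → PMF M.Cfg
  | 0 => PMF.pure (M.init x e)
  | t + 1 => (run O x e t).bind (M.next O)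

/-- The distribution of the string on the output tape after `t` steps. -/
def output (O : RandomizedMap) (x e : List Bool) (t : ℕ) : PMF (List Bool) :=
  (M.run O x e t).map fun c => tapeString (c.tape M.outputTape)

end OracleMachine

/-! ### Approximation-preserving reductions -/

/-- The value of a polynomial in `|x|` and `ε⁻¹`. -/
def polyBound (p : MvPolynomial (Fin 2) ℕ) (x e : List Bool) : ℝ :=
  MvPolynomial.aeval ![(x.length : ℝ), (errorValue e)⁻¹] p

/-- `M` is an approximation-preserving reduction from `f` to `g`. -/
structure IsAPReduction (M : OracleMachine) (f g : CountingProblem) : Prop where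
  /-- Whatever the oracle answers, each oracle call is an instance of `g` with an error bound `δ`
  for which `δ⁻¹` is polynomially bounded. -/
  calls : ∃ p : MvPolynomial (Fin 2) ℕ, ∀ x I, f.Encodes x I →
    ∀ e, errorValue e ∈ Set.Ioo (0 : ℝ) 1 → ∀ (O : RandomizedMap) (t : ℕ),
    ∀ c ∈ (M.run O x e t).support, c.state = M.query →
      (∃ J, g.Encodes (M.queryString c) J) ∧
      errorValue (M.queryError c) ∈ Set.Ioo (0 : ℝ) 1 ∧
      (errorValue (M.queryError c))⁻¹ ≤ polyBound p x e
  /-- Whatever the coins and the oracle's answers, `M` halts in polynomial time; and the output on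
  halting is a randomized approximation scheme for `f` if the oracle is one for `g`. -/
  halts_and_approximates : ∃ p : MvPolynomial (Fin 2) ℕ,
    (∀ x I, f.Encodes x I → ∀ e, errorValue e ∈ Set.Ioo (0 : ℝ) 1 →
      ∀ (O : RandomizedMap) (t : ℕ), polyBound p x e ≤ t →
      ∀ c ∈ (M.run O x e t).support, c.state = M.halt) ∧
    ∀ O : RandomizedMap, IsRAS O g → IsRAS (fun x e => M.output O x e ⌈polyBound p x e⌉₊) f

/-- `f` is AP-reducible to `g`. -/
def APReducible (f g : CountingProblem) : Prop :=
  ∃ M : OracleMachine, IsAPReduction M f g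

end

/-!
Let `c` be a largest clause of a normalized formula for `R`. Pin the arguments outside `c` as the
formula says, and to the value that satisfies a clause where it says nothing. By normalization no
pinned argument lies in `c` and every other clause has an argument outside `c`, so what is left of
`R` is an OR (or NAND) of `w` arguments. A hyper-edge with at most `w` vertices becomes one
constraint `R`: its vertices are put into `w` slots, the slots left over and the arguments outside
`c` hold fresh pinned variables, the former pinned to the value that does not affect the clause.
Satisfying assignments then correspond to independent sets, a vertex occurs as often as it lies in
a hyper-edge, and a fresh variable at most twice.

The reduction makes a single call with the error bound that it was given. In order that the machine
can number the fresh variables without arithmetic, every hyper-edge gets `r = R.arity` of them, all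
pinned, whether or not they occur in its constraint; the `j`-th one of the `i`-th hyper-edge is
`n + i * r + j`.
-/

/-! ### Tape programs -/

/-- Deterministic structured programs for `k` tapes, from which the machine of the reduction is
built. Tests depend on the scanned symbols only. -/
inductive TapeProgram (k : ℕ) : Type
  | skip
  | write (i : Fin k) (a : Option Bool)
  | move (i : Fin k) (D : Turing.Dir)
  | seq (p q : TapeProgram k)
  | loop (c : (Fin k → Option Bool) → Bool) (p : TapeProgram k)
  | ite (c : (Fin k → Option Bool) → Bool) (p q : TapeProgram k)

namespace TapeProgram

notation:60 p:61 " ⨾ " q:60 => TapeProgram.seq p q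

variable {k : ℕ}

/-- The contents and head positions of `k` tapes. -/
abbrev Tapes (k : ℕ) := Fin k → Turing.Tape (Option Bool)

/-- The scanned symbols. -/
def heads (T : Tapes k) : Fin k → Option Bool := fun i => (T i).head

/-- The effect of a machine step on the tapes: write, then move, on every tape. -/
def perform (a : Fin k → Option Bool × Option Turing.Dir) (T : Tapes k) : Tapes k :=
  fun i => OracleMachine.moveHead (a i).2 ((T i).write (a i).1)

/-- The control positions of a program; the additional position of a loop or a branching is that
of its test. -/
def Pos : TapeProgram k → Type
  | skip => Unit
  | write _ _ => Unit
  | move _ _ => Unit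
  | seq p q => p.Pos ⊕ q.Pos
  | loop _ p => Option p.Pos
  | ite _ p q => Option (p.Pos ⊕ q.Pos)

instance fintypePos : (p : TapeProgram k) → Fintype p.Pos
  | skip => inferInstanceAs (Fintype Unit)
  | write _ _ => inferInstanceAs (Fintype Unit)
  | move _ _ => inferInstanceAs (Fintype Unit)
  | seq p q =>
    letI := fintypePos p
    letI := fintypePos q
    inferInstanceAs (Fintype (p.Pos ⊕ q.Pos))
  | loop _ p =>
    letI := fintypePos p
    inferInstanceAs (Fintype (Option p.Pos))
  | ite _ p q =>
    letI := fintypePos p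
    letI := fintypePos q
    inferInstanceAs (Fintype (Option (p.Pos ⊕ q.Pos)))

/-- The control position at the start. -/
def entry : (p : TapeProgram k) → p.Pos
  | skip => ()
  | write _ _ => ()
  | move _ _ => ()
  | seq p _ => Sum.inl p.entry
  | loop _ _ => (none : Option _)
  | ite _ _ _ => (none : Option _)

/-- One step: the next position (`none` on leaving the program) and what to do to the tapes. -/
def trans : (p : TapeProgram k) → p.Pos → (Fin k → Option Bool) →
    Option p.Pos × (Fin k → Option Bool × Option Turing.Dir)
  | skip, _, h => (none, fun j => (h j, none))
  | write i a, _, h => (none, Function.update (fun j => (h j, none)) i (a, none))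
  | move i D, _, h => (none, Function.update (fun j => (h j, none)) i (h i, some D))
  | seq p q, Sum.inl s, h =>
    (some ((p.trans s h).1.elim (Sum.inr q.entry) Sum.inl), (p.trans s h).2)
  | seq _ q, Sum.inr s, h => ((q.trans s h).1.map Sum.inr, (q.trans s h).2)
  | loop c p, none, h => (if c h then some (some p.entry) else none, fun i => (h i, none))
  | loop _ p, some s, h => (some (p.trans s h).1, (p.trans s h).2)
  | ite c p q, none, h =>
    (some (some (if c h then Sum.inl p.entry else Sum.inr q.entry)), fun i => (h i, none))
  | ite _ p _, some (Sum.inl s), h =>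
    ((p.trans s h).1.map fun s => some (Sum.inl s), (p.trans s h).2)
  | ite _ _ q, some (Sum.inr s), h =>
    ((q.trans s h).1.map fun s => some (Sum.inr s), (q.trans s h).2)

/-- Started at position `s` with tapes `T`, the program is left after exactly `t` steps with
tapes `U`. -/
inductive Runs (p : TapeProgram k) : p.Pos → Tapes k → ℕ → Tapes k → Prop
  | exit {s : p.Pos} {T U : Tapes k} (h : (p.trans s (heads T)).1 = none)
      (hT : perform (p.trans s (heads T)).2 T = U) : Runs p s T 1 U
  | step {s s' : p.Pos} {T T₁ U : Tapes k} {t : ℕ} (h : (p.trans s (heads T)).1 = some s')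
      (hT : perform (p.trans s (heads T)).2 T = T₁) (hr : Runs p s' T₁ t U) :
      Runs p s T (t + 1) U

/-- The program turns the tapes `T` into `T'` within `b` steps. -/
def Computes (p : TapeProgram k) (T : Tapes k) (b : ℕ) (T' : Tapes k) : Prop :=
  ∃ t ≤ b, p.Runs p.entry T t T'

theorem perform_stay (T : Tapes k) : perform (fun i => (heads T i, none)) T = T :=
  funext fun i => Turing.Tape.write_self (T i)

theorem perform_update (T : Tapes k) (i : Fin k) (a : Option Bool × Option Turing.Dir) :
    perform (Function.update (fun j => (heads T j, none)) i a) T =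
      Function.update T i (OracleMachine.moveHead a.2 ((T i).write a.1)) := by
  funext j
  rcases eq_or_ne j i with rfl | hj
  · simp only [perform, Function.update_self]
  · simp only [perform, Function.update_of_ne hj]
    exact Turing.Tape.write_self (T j)

theorem Computes.mono {p : TapeProgram k} {T T' : Tapes k} {b b' : ℕ} (h : p.Computes T b T')
    (hb : b ≤ b') : p.Computes T b' T' :=
  let ⟨t, ht, hr⟩ := h
  ⟨t, ht.trans hb, hr⟩

theorem computes_skip (T : Tapes k) : skip.Computes T 1 T :=
  ⟨1, le_rfl, .exit rfl (perform_stay T)⟩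

theorem computes_write (i : Fin k) (a : Option Bool) (T : Tapes k) :
    (write i a).Computes T 1 (Function.update T i ((T i).write a)) :=
  ⟨1, le_rfl, .exit rfl (perform_update T i (a, none))⟩

theorem computes_move (i : Fin k) (D : Turing.Dir) (T : Tapes k) :
    (move i D).Computes T 1 (Function.update T i ((T i).move D)) := by
  refine ⟨1, le_rfl, .exit rfl ((perform_update T i (heads T i, some D)).trans ?_)⟩
  exact congrArg (fun X => Function.update T i (X.move D)) (Turing.Tape.write_self (T i))

theorem Runs.seq_right (p : TapeProgram k) {q : TapeProgram k} {s : q.Pos} {T T' : Tapes k}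
    {t : ℕ} (h : q.Runs s T t T') : (p ⨾ q).Runs (Sum.inr s) T t T' := by
  induction h with
  | exit h hT => exact .exit (by simp only [trans, h]; rfl) hT
  | step h hT _ ih => exact .step (by simp only [trans, h]; rfl) hT ih

theorem Runs.seq {p q : TapeProgram k} {s : p.Pos} {T T₁ T' : Tapes k} {t t' : ℕ}
    (h : p.Runs s T t T₁) (h' : q.Runs q.entry T₁ t' T') :
    (p ⨾ q).Runs (Sum.inl s) T (t' + t) T' := by
  induction h with
  | exit h hT => exact .step (by simp only [trans, h]; rfl) hT (h'.seq_right _)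
  | step h hT _ ih => exact .step (by simp only [trans, h]; rfl) hT (ih h')

theorem Computes.seq {p q : TapeProgram k} {T T₁ T' : Tapes k} {b b' : ℕ}
    (h : p.Computes T b T₁) (h' : q.Computes T₁ b' T') : (p ⨾ q).Computes T (b + b') T' := by
  obtain ⟨t, ht, hr⟩ := h
  obtain ⟨t', ht', hr'⟩ := h'
  exact ⟨t' + t, by omega, hr.seq hr'⟩

theorem Runs.loop {c : (Fin k → Option Bool) → Bool} {p : TapeProgram k} {s : p.Pos}
    {T T₁ T' : Tapes k} {t t' : ℕ} (h : p.Runs s T t T₁)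
    (h' : (loop c p).Runs (loop c p).entry T₁ t' T') :
    (loop c p).Runs (some s : Option p.Pos) T (t' + t) T' := by
  induction h with
  | exit h hT => exact .step (by simp only [trans, h]; rfl) hT h'
  | step h hT _ ih => exact .step (by simp only [trans, h]) hT (ih h')

theorem computes_loop_of_false {c : (Fin k → Option Bool) → Bool} (p : TapeProgram k)
    {T : Tapes k} (hc : c (heads T) = false) : (loop c p).Computes T 1 T :=
  ⟨1, le_rfl, .exit (by simp [trans, entry, hc]) (perform_stay T)⟩

theorem computes_loop_of_true {c : (Fin k → Option Bool) → Bool} {p : TapeProgram k}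
    {T T₁ T' : Tapes k} {b b' : ℕ} (hc : c (heads T) = true) (h : p.Computes T b T₁)
    (h' : (loop c p).Computes T₁ b' T') : (loop c p).Computes T (b + b' + 1) T' := by
  obtain ⟨t, ht, hr⟩ := h
  obtain ⟨t', ht', hr'⟩ := h'
  exact ⟨t' + t + 1, by omega,
    .step (by simp only [trans, entry, hc]; rfl) (perform_stay T) (hr.loop hr')⟩

theorem computes_loop_transfer {c : (Fin k → Option Bool) → Bool} {p : TapeProgram k} {t : ℕ}
    (S : ℕ → ℕ → Tapes k) (hc : ∀ a b, c (heads (S (a + 1) b)) = true)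
    (hp : ∀ a b, p.Computes (S (a + 1) b) t (S a (b + 1)))
    (hc₀ : ∀ b, c (heads (S 0 b)) = false) (a : ℕ) :
    (loop c p).Computes (S a 0) (a * (t + 1) + 1) (S 0 a) := by
  suffices h : ∀ b, (loop c p).Computes (S a b) (a * (t + 1) + 1) (S 0 (a + b)) from h 0
  induction a with
  | zero =>
    intro b
    rw [zero_mul, zero_add, zero_add]
    exact computes_loop_of_false p (hc₀ b)
  | succ a ih =>
    intro b
    rw [add_right_comm, add_assoc]
    exact (computes_loop_of_true (hc a b) (hp a b) (ih (b + 1))).mono (by rw [add_one_mul]; omega)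

theorem Runs.ite_left {c : (Fin k → Option Bool) → Bool} {p : TapeProgram k} (q : TapeProgram k)
    {s : p.Pos} {T T' : Tapes k} {t : ℕ} (h : p.Runs s T t T') :
    (ite c p q).Runs (some (Sum.inl s) : Option (p.Pos ⊕ q.Pos)) T t T' := by
  induction h with
  | exit h hT => exact .exit (by simp only [trans, h]; rfl) hT
  | step h hT _ ih => exact .step (by simp only [trans, h]; rfl) hT ih

theorem Runs.ite_right {c : (Fin k → Option Bool) → Bool} (p : TapeProgram k) {q : TapeProgram k}
    {s : q.Pos} {T T' : Tapes k} {t : ℕ} (h : q.Runs s T t T') :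
    (ite c p q).Runs (some (Sum.inr s) : Option (p.Pos ⊕ q.Pos)) T t T' := by
  induction h with
  | exit h hT => exact .exit (by simp only [trans, h]; rfl) hT
  | step h hT _ ih => exact .step (by simp only [trans, h]; rfl) hT ih

theorem computes_ite_of_true {c : (Fin k → Option Bool) → Bool} {p : TapeProgram k}
    (q : TapeProgram k) {T T' : Tapes k} {b : ℕ} (hc : c (heads T) = true)
    (h : p.Computes T b T') : (ite c p q).Computes T (b + 1) T' := by
  obtain ⟨t, ht, hr⟩ := h
  exact ⟨t + 1, by omega,
    .step (by simp only [trans, entry, hc]; rfl) (perform_stay T) (hr.ite_left q)⟩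

theorem computes_ite_of_false {c : (Fin k → Option Bool) → Bool} (p : TapeProgram k)
    {q : TapeProgram k} {T T' : Tapes k} {b : ℕ} (hc : c (heads T) = false)
    (h : q.Computes T b T') : (ite c p q).Computes T (b + 1) T' := by
  obtain ⟨t, ht, hr⟩ := h
  exact ⟨t + 1, by omega,
    .step (by simp only [trans, entry, hc]; rfl) (perform_stay T) (hr.ite_right p)⟩

/-! ### Machines with a single oracle call -/

/-- The machine that runs `p`, then makes an oracle call with the string on tape `2` and the error
bound on tape `1`, and returns the answer. It ignores its coins. The states outside `p` are the
query (`false`) and the end (`true`). -/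
noncomputable def machine (p : TapeProgram (k + 4)) : OracleMachine where
  k := k + 4
  State := p.Pos ⊕ Bool
  decEqState := Classical.decEq _
  start := Sum.inl p.entry
  halt := Sum.inr true
  query := Sum.inr false
  resume := Sum.inr true
  inputTape := 0
  errorTape := 1
  input_ne_error := by simp
  queryTape := 2
  queryErrorTape := 1
  query_ne_queryError := by simp [Fin.ext_iff, Nat.mod_eq_of_lt]
  answerTape := 3
  outputTape := 3
  step s h _ := match s with
    | Sum.inl s => ((p.trans s h).1.elim (Sum.inr false) Sum.inl, (p.trans s h).2)
    | Sum.inr b => (Sum.inr b, fun i => (h i, none))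

/-- The tapes at the start. -/
def initTapes (k : ℕ) (x e : List Bool) : Tapes (k + 4) := fun i =>
  if i = 0 then OracleMachine.stringTape x
    else if i = 1 then OracleMachine.stringTape e else OracleMachine.stringTape []

/-- The configuration of the machine at a given position. -/
noncomputable def cfg (p : TapeProgram (k + 4)) (s : p.Pos ⊕ Bool) (T : Tapes (k + 4)) :
    p.machine.Cfg :=
  ⟨s, T⟩

section machine

variable (p : TapeProgram (k + 4)) (O : RandomizedMap) (T : Tapes (k + 4))

theorem machine_next_pos (s : p.Pos) :
    p.machine.next O (p.cfg (Sum.inl s) T) = PMF.pure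
      (p.cfg ((p.trans s (heads T)).1.elim (Sum.inr false) Sum.inl)
        (perform (p.trans s (heads T)).2 T)) := by
  refine (if_neg Sum.inl_ne_inr).trans ((if_neg Sum.inl_ne_inr).trans ?_)
  exact PMF.map_const (PMF.uniformOfFintype Bool)
    (p.cfg ((p.trans s (heads T)).1.elim (Sum.inr false) Sum.inl)
      (perform (p.trans s (heads T)).2 T))

theorem machine_next_query :
    p.machine.next O (p.cfg (Sum.inr false) T) =
      (O (tapeString (T 2)) (tapeString (T 1))).map
        fun s => p.cfg (Sum.inr true) (Function.update T 3 (OracleMachine.stringTape s)) :=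
  (if_neg (Sum.inr_injective.ne Bool.false_ne_true)).trans (if_pos rfl)

theorem machine_next_halt :
    p.machine.next O (p.cfg (Sum.inr true) T) = PMF.pure (p.cfg (Sum.inr true) T) :=
  if_pos rfl

end machine

section run

variable {p : TapeProgram (k + 4)} {O : RandomizedMap} {x e : List Bool} {T T' : Tapes (k + 4)}
  {t : ℕ}

theorem Runs.machine_run {s : p.Pos} (h : p.Runs s T t T') : ∀ t₀ : ℕ,
    p.machine.run O x e t₀ = PMF.pure (p.cfg (Sum.inl s) T) →
    (∀ u < t, ∃ s' T₁, p.machine.run O x e (t₀ + u) = PMF.pure (p.cfg (Sum.inl s') T₁)) ∧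
      p.machine.run O x e (t₀ + t) = PMF.pure (p.cfg (Sum.inr false) T') := by
  induction h with
  | @exit s T T' h hT =>
    intro t₀ h₀
    refine ⟨fun u hu => ⟨s, T, by rwa [Nat.lt_one_iff.1 hu]⟩, ?_⟩
    rw [OracleMachine.run, h₀, PMF.pure_bind, machine_next_pos, h, hT]
    rfl
  | @step s s' T T₁ T' t h hT _ ih =>
    intro t₀ h₀
    have h₁ : p.machine.run O x e (t₀ + 1) = PMF.pure (p.cfg (Sum.inl s') T₁) := by
      rw [OracleMachine.run, h₀, PMF.pure_bind, machine_next_pos, h, hT]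
      rfl
    obtain ⟨ih₁, ih₂⟩ := ih (t₀ + 1) h₁
    refine ⟨fun u hu => ?_, by rwa [add_right_comm, add_assoc] at ih₂⟩
    cases u with
    | zero => exact ⟨s, T, h₀⟩
    | succ u => simpa only [add_right_comm, add_assoc] using ih₁ u (by omega)

theorem machine_run_of_lt (h : p.Runs p.entry (initTapes k x e) t T) {u : ℕ} (hu : u < t) :
    ∃ s' T₁, p.machine.run O x e u = PMF.pure (p.cfg (Sum.inl s') T₁) := by
  simpa only [zero_add] using (h.machine_run (O := O) 0 rfl).1 u hu

theorem machine_run_query (h : p.Runs p.entry (initTapes k x e) t T) :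
    p.machine.run O x e t = PMF.pure (p.cfg (Sum.inr false) T) := by
  simpa only [zero_add] using (h.machine_run (O := O) 0 rfl).2

theorem machine_run_of_gt (h : p.Runs p.entry (initTapes k x e) t T) {u : ℕ} (hu : t < u) :
    p.machine.run O x e u = (O (tapeString (T 2)) (tapeString (T 1))).map
      fun s => p.cfg (Sum.inr true) (Function.update T 3 (OracleMachine.stringTape s)) := by
  induction u, hu using Nat.le_induction with
  | base => rw [OracleMachine.run, machine_run_query h, PMF.pure_bind, machine_next_query]
  | succ u _ ih =>
    rw [OracleMachine.run, ih, PMF.bind_map]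
    exact congrArg (PMF.bind _) (funext fun s => machine_next_halt p O _)

theorem eq_of_mem_support_run_of_query (h : p.Runs p.entry (initTapes k x e) t T) {u : ℕ}
    {c : p.machine.Cfg} (hc : c ∈ (p.machine.run O x e u).support)
    (hq : c.state = p.machine.query) : c = p.cfg (Sum.inr false) T := by
  rcases lt_trichotomy u t with hu | rfl | hu
  · obtain ⟨s, T₁, hs⟩ := machine_run_of_lt (O := O) h hu
    rw [hs, PMF.support_pure, Set.mem_singleton_iff] at hc
    subst hc
    exact absurd hq Sum.inl_ne_inr
  · rwa [machine_run_query h, PMF.support_pure, Set.mem_singleton_iff] at hc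
  · rw [machine_run_of_gt h hu, PMF.mem_support_map_iff] at hc
    obtain ⟨s, -, rfl⟩ := hc
    exact absurd (Sum.inr_injective hq) Bool.false_ne_true.symm

theorem state_eq_halt_of_mem_support_run (h : p.Runs p.entry (initTapes k x e) t T) {u : ℕ}
    (hu : t < u) {c : p.machine.Cfg} (hc : c ∈ (p.machine.run O x e u).support) :
    c.state = p.machine.halt := by
  rw [machine_run_of_gt h hu, PMF.mem_support_map_iff] at hc
  obtain ⟨s, -, rfl⟩ := hc
  rfl

end run

end TapeProgram

theorem halfTapeString_mk_map_some (s : List Bool) :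
    halfTapeString (Turing.ListBlank.mk (s.map some)) = s :=
  (List.filterMap_map ..).trans List.filterMap_some

theorem tapeString_stringTape (s : List Bool) :
    tapeString (OracleMachine.stringTape s) = s := by
  rw [tapeString, OracleMachine.stringTape, Turing.Tape.mk₁, Turing.Tape.mk₂,
    Turing.Tape.mk'_left, Turing.Tape.mk'_right₀, halfTapeString_mk_map_some]
  rfl

theorem TapeProgram.machine_output {k : ℕ} {p : TapeProgram (k + 4)} {O : RandomizedMap}
    {x e : List Bool} {t : ℕ} {T : Tapes (k + 4)} (h : p.Runs p.entry (initTapes k x e) t T)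
    {u : ℕ} (hu : t < u) :
    p.machine.output O x e u = O (tapeString (T 2)) (tapeString (T 1)) := by
  rw [OracleMachine.output, machine_run_of_gt h hu, PMF.map_comp]
  convert PMF.map_id _ using 2
  funext s
  exact tapeString_stringTape s

theorem polyBound_aeval_add_one (P : Polynomial ℕ) (x e : List Bool) :
    polyBound (Polynomial.aeval (MvPolynomial.X 0) P + 1) x e =
      ((P.eval x.length + 1 : ℕ) : ℝ) := by
  rw [polyBound, map_add, map_one, ← Polynomial.aeval_algHom_apply, MvPolynomial.aeval_X,
    Matrix.cons_val_zero, Nat.cast_add, Nat.cast_one]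
  exact congrArg (· + 1) (Polynomial.aeval_algebraMap_apply_eq_algebraMap_eval x.length P)

open TapeProgram in
theorem apReducible_of_computes {f g : CountingProblem} {k : ℕ} (p : TapeProgram (k + 4))
    (P : Polynomial ℕ)
    (h : ∀ x I, f.Encodes x I → ∃ y J, g.Encodes y J ∧ g.count J = f.count I ∧
      ∀ e, ∃ T, p.Computes (initTapes k x e) (P.eval x.length) T ∧ tapeString (T 2) = y ∧
        tapeString (T 1) = e) :
    APReducible f g := by
  refine ⟨p.machine, ⟨MvPolynomial.X 1, fun x I hI e he O t c hc hq => ?_⟩,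
    Polynomial.aeval (MvPolynomial.X 0) P + 1, fun x I hI e _ O t ht c hc => ?_,
    fun O hO x I hI e he => ?_⟩ <;>
  obtain ⟨y, J, hJ, hcount, hy⟩ := h x I hI <;>
  obtain ⟨T, ⟨t', ht', hr⟩, h2, h1⟩ := hy e
  · rw [eq_of_mem_support_run_of_query hr hc hq]
    have hstring : p.machine.queryString (p.cfg (Sum.inr false) T) = y := h2
    have herror : p.machine.queryError (p.cfg (Sum.inr false) T) = e := h1
    rw [hstring, herror]
    exact ⟨⟨J, hJ⟩, he, by simp [polyBound]⟩
  · rw [polyBound_aeval_add_one, Nat.cast_le] at ht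
    exact state_eq_halt_of_mem_support_run hr (by omega) hc
  · change Approximates (p.machine.output O x e _) _ _
    rw [polyBound_aeval_add_one, Nat.ceil_natCast, machine_output hr (by omega), h1, h2, ← hcount]
    exact hO y J hJ e he

/-! ### Strings, stacks and counters on tapes -/

/-- The tape with `l` (read from the head outwards) to the left and `r` to the right; the head
scans the first symbol of `r`. -/
def listTape (l r : List (Option Bool)) : Turing.Tape (Option Bool) :=
  Turing.Tape.mk' (Turing.ListBlank.mk l) (Turing.ListBlank.mk r)

section listTape

variable (l r : List (Option Bool)) (a : Option Bool)

theorem listBlank_mk_blank :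
    (Turing.ListBlank.mk [none] : Turing.ListBlank (Option Bool)) = Turing.ListBlank.mk [] :=
  Turing.ListBlank.ext fun i => by cases i <;> rfl

theorem listTape_blank_left : listTape [none] r = listTape [] r := by
  rw [listTape, listBlank_mk_blank, listTape]

theorem listTape_blank_right : listTape l [none] = listTape l [] := by
  rw [listTape, listBlank_mk_blank, listTape]

theorem listTape_write : (listTape l r).write a = listTape l (a :: r.tail) := rfl

theorem listTape_move_right :
    (listTape l (a :: r)).move Turing.Dir.right = listTape (a :: l) r := by
  simp [listTape]

theorem listTape_move_left : (listTape (a :: l) r).move Turing.Dir.left = listTape l (a :: r) := by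
  simp [listTape]

end listTape

/-- A stack with its top to the left; the head scans the blank in front of the top. -/
def stackTape (q : List Bool) : Turing.Tape (Option Bool) := listTape [] (none :: q.map some)

theorem tapeString_stackTape (q : List Bool) : tapeString (stackTape q) = q := by
  rw [tapeString, stackTape, listTape, Turing.Tape.mk'_left, Turing.Tape.mk'_right₀]
  exact halfTapeString_mk_map_some q

/-- The counter value `v`, in unary to the left of the head, and `r` from the head on. -/
def counterTape (v : ℕ) (r : List (Option Bool)) : Turing.Tape (Option Bool) :=
  listTape (List.replicate v (some true)) r

theorem counterTape_succ (v : ℕ) (r : List (Option Bool)) :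
    (counterTape (v + 1) r).move Turing.Dir.left = counterTape v (some true :: r) :=
  listTape_move_left ..

theorem counterTape_cons_move_right (v : ℕ) (r : List (Option Bool)) :
    (counterTape v (some true :: r)).move Turing.Dir.right = counterTape (v + 1) r :=
  listTape_move_right ..

theorem counterTape_zero_move_left_head (r : List (Option Bool)) :
    ((counterTape 0 r).move Turing.Dir.left).head = none := by
  rw [counterTape, List.replicate_zero, ← listTape_blank_left, listTape_move_left]
  rfl

namespace TapeProgram

variable {k : ℕ} {i j : Fin k} {T : Tapes k}

/-- The test whether tape `i` scans the symbol `b`. -/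
def scans (i : Fin k) (b : Bool) (h : Fin k → Option Bool) : Bool := h i == some b

/-- Write a symbol, then move the head. -/
def put (i : Fin k) (a : Option Bool) (D : Turing.Dir) : TapeProgram k := write i a ⨾ move i D

theorem computes_put {a : Option Bool} {D : Turing.Dir} {X : Turing.Tape (Option Bool)}
    (h : ((T i).write a).move D = X) : (put i a D).Computes T 2 (Function.update T i X) := by
  have h' := (computes_write i a T).seq (computes_move i D _)
  rwa [Function.update_self, Function.update_idem, h] at h'

/-- Remove the first symbol of the string on tape `i`. -/
def pop (i : Fin k) : TapeProgram k := put i none Turing.Dir.right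

theorem computes_pop {b : Bool} {s : List Bool} (h : T i = OracleMachine.stringTape (b :: s)) :
    (pop i).Computes T 2 (Function.update T i (OracleMachine.stringTape s)) :=
  computes_put (by
    rw [h]
    exact (listTape_move_right [] (s.map some) none).trans (listTape_blank_left _))

/-- Push the symbol `b` on the stack on tape `i`. -/
def push (i : Fin k) (b : Bool) : TapeProgram k := put i (some b) Turing.Dir.left

theorem computes_push {q : List Bool} (h : T i = stackTape q) (b : Bool) :
    (push i b).Computes T 2 (Function.update T i (stackTape (b :: q))) :=
  computes_put (by
    rw [h, stackTape, listTape_write, ← listTape_blank_left, listTape_move_left]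
    rfl)

/-- Push a constant in unary. -/
def pushUnary (i : Fin k) : ℕ → TapeProgram k
  | 0 => push i false
  | t + 1 => pushUnary i t ⨾ push i true

theorem computes_pushUnary {q : List Bool} (h : T i = stackTape q) (t : ℕ) :
    (pushUnary i t).Computes T (2 * t + 2) (Function.update T i (stackTape (unary t ++ q))) := by
  induction t with
  | zero => exact computes_push h false
  | succ t ih =>
    have h' := ih.seq (computes_push (Function.update_self ..) true)
    rw [Function.update_idem] at h'
    exact h'

/-- Increment the counter on tape `i`, overwriting the scanned symbol. -/
def inc (i : Fin k) : TapeProgram k := put i (some true) Turing.Dir.right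

theorem computes_inc {v : ℕ} {r : List (Option Bool)} (h : T i = counterTape v r) :
    (inc i).Computes T 2 (Function.update T i (counterTape (v + 1) r.tail)) :=
  computes_put (by rw [h]; exact counterTape_cons_move_right v r.tail)

/-- Add a constant to the counter on tape `i`. -/
def incs (i : Fin k) : ℕ → TapeProgram k
  | 0 => skip
  | t + 1 => incs i t ⨾ inc i

theorem computes_incs {v : ℕ} (h : T i = counterTape v []) (t : ℕ) :
    (incs i t).Computes T (2 * t + 1) (Function.update T i (counterTape (v + t) [])) := by
  induction t with
  | zero =>
    rw [add_zero, ← h, Function.update_eq_self]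
    exact computes_skip T
  | succ t ih =>
    have h' := ih.seq (computes_inc (Function.update_self ..))
    rw [Function.update_idem] at h'
    exact h'.mono (by omega)

/-- Decrement the counter on tape `i`. -/
def dec (i : Fin k) : TapeProgram k := move i Turing.Dir.left ⨾ write i none

theorem computes_dec {v : ℕ} (h : T i = counterTape (v + 1) []) :
    (dec i).Computes T 2 (Function.update T i (counterTape v [])) := by
  have h' := (computes_move i Turing.Dir.left T).seq (computes_write i none _)
  rw [Function.update_self, Function.update_idem, h, counterTape_succ, counterTape,
    listTape_write] at h'
  rwa [List.tail_cons, listTape_blank_right] at h'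

/-- Push a symbol on the stack on tape `j` while moving one cell to the left on tape `i`. -/
def pushLeft (i j : Fin k) (b : Bool) : TapeProgram k := push j b ⨾ move i Turing.Dir.left

theorem computes_pushLeft (hij : i ≠ j) {X : Turing.Tape (Option Bool)} {q : List Bool}
    (hi : (T i).move Turing.Dir.left = X) (hj : T j = stackTape q) (b : Bool) :
    (pushLeft i j b).Computes T 3
      (Function.update (Function.update T i X) j (stackTape (b :: q))) := by
  have h := (computes_push hj b).seq (computes_move i Turing.Dir.left _)
  rwa [Function.update_of_ne hij, hi, Function.update_comm hij.symm] at h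

/-- Push the value of the counter on tape `i` in unary on the stack on tape `j`. -/
def emit (i j : Fin k) : TapeProgram k :=
  pushLeft i j false ⨾ loop (scans i true) (pushLeft i j true) ⨾
    move i Turing.Dir.right ⨾ loop (scans i true) (move i Turing.Dir.right)

theorem computes_sweep_left (hij : i ≠ j) (T : Tapes k) (v : ℕ) (r : List (Option Bool))
    (q : List Bool) :
    (loop (scans i true) (pushLeft i j true)).Computes
      (Function.update (Function.update T i ((counterTape v r).move Turing.Dir.left)) j
        (stackTape q)) (v * 4 + 1)
      (Function.update (Function.update T i
          ((counterTape 0 (List.replicate v (some true) ++ r)).move Turing.Dir.left)) j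
        (stackTape (List.replicate v true ++ q))) := by
  refine computes_loop_transfer (fun a b => Function.update (Function.update T i
    ((counterTape a (List.replicate b (some true) ++ r)).move Turing.Dir.left)) j
      (stackTape (List.replicate b true ++ q))) (fun a b => ?_) (fun a b => ?_) (fun b => ?_) v
  · simp only [heads, scans, Function.update_of_ne hij, Function.update_self, counterTape_succ]
    rfl
  · convert computes_pushLeft hij rfl (Function.update_self ..) true using 1
    simp only [Function.update_of_ne hij, Function.update_self, counterTape_succ,
      Function.update_comm hij, Function.update_idem]
    rfl
  · simp only [heads, scans, Function.update_of_ne hij, Function.update_self,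
      counterTape_zero_move_left_head]
    rfl

theorem computes_sweep_right (T : Tapes k) (i : Fin k) (v : ℕ) {r : List (Option Bool)}
    (hr : r.head? ≠ some (some true)) :
    (loop (scans i true) (move i Turing.Dir.right)).Computes
      (Function.update T i (counterTape 0 (List.replicate v (some true) ++ r))) (v * 2 + 1)
      (Function.update T i (counterTape v r)) := by
  refine computes_loop_transfer (fun a b => Function.update T i
    (counterTape b (List.replicate a (some true) ++ r))) (fun a b => ?_) (fun a b => ?_)
    (fun b => ?_) v
  · simp only [heads, scans, Function.update_self]
    rfl
  · have h := computes_move i Turing.Dir.right (Function.update T i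
      (counterTape b (some true :: (List.replicate a (some true) ++ r))))
    rwa [Function.update_idem, Function.update_self, counterTape_cons_move_right] at h
  · simp only [heads, scans, Function.update_self]
    cases r with
    | nil => rfl
    | cons c r => simpa [counterTape, listTape] using hr

theorem computes_emit (hij : i ≠ j) {v : ℕ} {r : List (Option Bool)} {q : List Bool}
    (hr : r.head? ≠ some (some true)) (hi : T i = counterTape v r) (hj : T j = stackTape q) :
    (emit i j).Computes T (6 * v + 6) (Function.update T j (stackTape (unary v ++ q))) := by
  have hstack : unary v ++ q = List.replicate v true ++ false :: q := List.append_assoc ..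
  have hpush := computes_pushLeft hij (congrArg _ hi) hj false
  have hleft := computes_sweep_left hij T v r (false :: q)
  have hmove := computes_move i Turing.Dir.right (Function.update (Function.update T i
    ((counterTape 0 (List.replicate v (some true) ++ r)).move Turing.Dir.left)) j
      (stackTape (unary v ++ q)))
  have hright := computes_sweep_right (Function.update T j (stackTape (unary v ++ q))) i v hr
  simp only [Function.update_of_ne hij, Function.update_self, Turing.Tape.move_left_right,
    Function.update_comm hij, Function.update_idem] at hpush hleft hmove
  rw [← hstack] at hleft
  have hi' : Function.update T j (stackTape (unary v ++ q)) i = counterTape v r :=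
    (Function.update_of_ne hij ..).trans hi
  rw [← hi', Function.update_eq_self] at hright
  exact (hpush.seq (hleft.seq (hmove.seq hright))).mono (by omega)

end TapeProgram

/-! ### The instance written by the reduction -/

/-- The scope of a gadget: its designated slots are filled with the entries of the list, from the
last slot downwards. A position that gets no entry stands for a fresh variable. -/
def fill {α : Type*} : {r : ℕ} → (Fin r → Bool) → List α → Fin r → Option α
  | 0, _, _ => Fin.elim0
  | r + 1, slot, es =>
    Fin.snoc (α := fun _ => Option α)
      (fill (Fin.init slot) (if slot (Fin.last r) then es.tail else es))
      (if slot (Fin.last r) then es.head? else none)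

section fill

variable {α β : Type*} {r : ℕ}

theorem fill_last (slot : Fin (r + 1) → Bool) (es : List α) :
    fill slot es (Fin.last r) = if slot (Fin.last r) then es.head? else none :=
  Fin.snoc_last ..

theorem fill_castSucc (slot : Fin (r + 1) → Bool) (es : List α) (j : Fin r) :
    fill slot es j.castSucc =
      fill (Fin.init slot) (if slot (Fin.last r) then es.tail else es) j :=
  Fin.snoc_castSucc ..

theorem fill_map (f : α → β) (slot : Fin r → Bool) (es : List α) (j : Fin r) :
    fill slot (es.map f) j = (fill slot es j).map f := by
  induction r generalizing es with
  | zero => exact j.elim0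
  | succ r ih =>
    cases j using Fin.lastCases with
    | last => rw [fill_last, fill_last, List.head?_map, apply_ite (Option.map f), Option.map_none]
    | cast j => rw [fill_castSucc, fill_castSucc, ← List.map_tail, ← apply_ite (List.map f), ih]

theorem of_fill_eq_some {slot : Fin r → Bool} {es : List α} {j : Fin r} {a : α}
    (h : fill slot es j = some a) : slot j = true ∧ a ∈ es := by
  induction r generalizing es with
  | zero => exact j.elim0
  | succ r ih =>
    cases j using Fin.lastCases with
    | last =>
      rw [fill_last] at h
      split_ifs at h with hslot
      exact ⟨hslot, List.mem_of_mem_head? h⟩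
    | cast j =>
      rw [fill_castSucc] at h
      obtain ⟨hslot, ha⟩ := ih h
      refine ⟨hslot, ?_⟩
      split_ifs at ha
      exacts [List.mem_of_mem_tail ha, ha]

theorem eq_of_fill_eq_some {slot : Fin r → Bool} {es : List α} (hes : es.Nodup) {j j' : Fin r}
    {a : α} (h : fill slot es j = some a) (h' : fill slot es j' = some a) : j = j' := by
  induction r generalizing es with
  | zero => exact j.elim0
  | succ r ih =>
    have hlast {i : Fin r} (hl : fill slot es (Fin.last r) = some a)
        (hc : fill slot es i.castSucc = some a) : False := by
      rw [fill_last] at hl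
      split_ifs at hl with hslot
      rw [fill_castSucc, if_pos hslot] at hc
      obtain ⟨es, rfl⟩ := List.head?_eq_some_iff.1 hl
      exact (List.nodup_cons.1 hes).1 (of_fill_eq_some hc).2
    cases j using Fin.lastCases with
    | last =>
      cases j' using Fin.lastCases with
      | last => rfl
      | cast j' => exact (hlast h h').elim
    | cast j =>
      cases j' using Fin.lastCases with
      | last => exact (hlast h' h).elim
      | cast j' =>
        rw [fill_castSucc] at h h'
        refine congrArg _ (ih ?_ h h')
        split_ifs
        exacts [hes.tail, hes]

theorem exists_fill_eq_some {slot : Fin r → Bool} {es : List α}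
    (hes : es.length ≤ (Finset.univ.filter fun j => slot j = true).card) {a : α} (ha : a ∈ es) :
    ∃ j, fill slot es j = some a := by
  induction r generalizing es with
  | zero =>
    rw [Finset.univ_eq_empty, Finset.filter_empty, Finset.card_empty, Nat.le_zero] at hes
    exact absurd ha (by simp [List.length_eq_zero_iff.1 hes])
  | succ r ih =>
    rw [Finset.card_filter, Fin.sum_univ_castSucc, ← Finset.card_filter] at hes
    by_cases hslot : slot (Fin.last r) = true
    · rw [if_pos hslot] at hes
      obtain ⟨b, es, rfl⟩ := List.exists_cons_of_ne_nil (List.ne_nil_of_mem ha)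
      rcases List.mem_cons.1 ha with rfl | ha
      · exact ⟨Fin.last r, by rw [fill_last, if_pos hslot, List.head?_cons]⟩
      · obtain ⟨j, hj⟩ := ih (slot := Fin.init slot) (Nat.succ_le_succ_iff.1 hes) ha
        exact ⟨j.castSucc, by rw [fill_castSucc, if_pos hslot, List.tail_cons, hj]⟩
    · rw [if_neg hslot] at hes
      obtain ⟨j, hj⟩ := ih (slot := Fin.init slot) hes ha
      exact ⟨j.castSucc, by rw [fill_castSucc, if_neg hslot, hj]⟩

end fill

/-- The position in `[R] ++ pinLanguage` of the pin to the value `b`. -/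
def pinName (b : Bool) : ℕ := bif b then 2 else 1

theorem pinName_le (b : Bool) : pinName b ≤ 2 := by cases b <;> decide

/-- The code of the scope of a gadget with fresh variables `f`, `f + 1`, …. -/
def scopeCode {r : ℕ} (slot : Fin r → Bool) (f : ℕ) (es : List ℕ) : List Bool :=
  (List.ofFn fun j => (fill slot es j).getD (f + j)).flatMap unary

/-- The code of the pins of the fresh variables `f`, `f + 1`, …, the last one first. -/
def pinsCode {r : ℕ} (val : Fin r → Bool) (f : ℕ) : List Bool :=
  (List.finRange r).reverse.flatMap fun j => unary (pinName (val j)) ++ unary (f + j)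

/-- The code of the constraints that replace a hyper-edge with vertex list `es`. -/
def gadgetCode {r : ℕ} (slot val : Fin r → Bool) (f : ℕ) (es : List ℕ) : List Bool :=
  unary 0 ++ scopeCode slot f es ++ pinsCode val f

/-- The code of the constraints that replace the hyper-edges with characteristic vectors `rows`,
the last one first. -/
def gadgetsCode {r m : ℕ} (slot val : Fin r → Bool) (f : ℕ) (rows : Fin m → List Bool) :
    List Bool :=
  (List.finRange m).reverse.flatMap fun i : Fin m =>
    gadgetCode slot val (f + i * r) ((rows i).findIdxs id)

theorem scopeCode_succ {r : ℕ} (slot : Fin (r + 1) → Bool) (f : ℕ) (es : List ℕ) :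
    scopeCode slot f es =
      scopeCode (Fin.init slot) f (if slot (Fin.last r) then es.tail else es) ++
        unary ((if slot (Fin.last r) then es.head? else none).getD (f + r)) := by
  rw [scopeCode, List.ofFn_succ', List.concat_eq_append, List.flatMap_append,
    List.flatMap_singleton, fill_last]
  simp only [fill_castSucc]
  rfl

theorem pinsCode_succ {r : ℕ} (val : Fin (r + 1) → Bool) (f : ℕ) :
    pinsCode val f =
      unary (pinName (val (Fin.last r))) ++ unary (f + r) ++ pinsCode (Fin.init val) f := by
  rw [pinsCode, List.finRange_succ_last, List.reverse_append, List.flatMap_append,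
    ← List.map_reverse, List.flatMap_map]
  simp only [List.reverse_singleton, List.flatMap_singleton]
  rfl

theorem gadgetsCode_succ {r m : ℕ} (slot val : Fin r → Bool) (f : ℕ)
    (rows : Fin (m + 1) → List Bool) :
    gadgetsCode slot val f rows = gadgetsCode slot val (f + r) (Fin.tail rows) ++
      gadgetCode slot val f ((rows 0).findIdxs id) := by
  rw [gadgetsCode, List.finRange_succ, List.reverse_cons, List.flatMap_append,
    ← List.map_reverse, List.flatMap_map]
  simp only [List.flatMap_singleton, Fin.val_zero, zero_mul, add_zero, Fin.val_succ, add_mul,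
    one_mul, add_comm _ r, ← add_assoc]
  rfl

/-! ### The program of the reduction -/

namespace TapeProgram

abbrev inputTape : Fin 6 := 0

/-- The tape on which the query is written. -/
abbrev queryTape : Fin 6 := 2

/-- The work tape with the counter of the variables used so far. -/
abbrev freshTape : Fin 6 := 4

/-- The work tape with the position in the current hyper-edge. -/
abbrev vertexTape : Fin 6 := 5

/-- The work tape in the middle of a row: `v` symbols have been read, `u` are left. -/
def rowTape (v u : ℕ) : Turing.Tape (Option Bool) := counterTape v (List.replicate u (some false))

/-- The tapes of the reduction: the error bound `e`, the rest `s` of the input, the part `q` of the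
query written so far, `f` variables used and `v` of the `v + u` symbols of a row read. -/
def layout (e s q : List Bool) (f v u : ℕ) : Tapes 6 :=
  ![OracleMachine.stringTape s, OracleMachine.stringTape e, stackTape q,
    OracleMachine.stringTape [], counterTape f [], rowTape v u]

section layout

variable (e s q : List Bool) (f v u : ℕ)

theorem update_layout_input (s' : List Bool) :
    Function.update (layout e s q f v u) inputTape (OracleMachine.stringTape s') =
      layout e s' q f v u := by
  funext i
  fin_cases i <;> rfl

theorem update_layout_query (q' : List Bool) :
    Function.update (layout e s q f v u) queryTape (stackTape q') = layout e s q' f v u := by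
  funext i
  fin_cases i <;> rfl

theorem update_layout_fresh (f' : ℕ) :
    Function.update (layout e s q f v u) freshTape (counterTape f' []) =
      layout e s q f' v u := by
  funext i
  fin_cases i <;> rfl

theorem update_layout_vertex (v' u' : ℕ) :
    Function.update (layout e s q f v u) vertexTape (rowTape v' u') = layout e s q f v' u' := by
  funext i
  fin_cases i <;> rfl

theorem initTapes_eq_layout : initTapes 2 s e = layout e s [] 0 0 0 := by
  have h : OracleMachine.stringTape [] = stackTape [] := (listTape_blank_right []).symm
  funext i
  fin_cases i <;> first | exact h | rfl

theorem computes_pop_input (b : Bool) :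
    (pop inputTape).Computes (layout e (b :: s) q f v u) 2 (layout e s q f v u) := by
  have h := computes_pop (T := layout e (b :: s) q f v u) (i := inputTape) rfl
  rwa [update_layout_input] at h

theorem computes_inc_fresh :
    (inc freshTape).Computes (layout e s q f v u) 2 (layout e s q (f + 1) v u) := by
  have h := computes_inc (T := layout e s q f v u) (i := freshTape) rfl
  rwa [List.tail_nil, update_layout_fresh] at h

theorem computes_incs_fresh (t : ℕ) :
    (incs freshTape t).Computes (layout e s q f v u) (2 * t + 1) (layout e s q (f + t) v u) := by
  have h := computes_incs (T := layout e s q f v u) (i := freshTape) rfl t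
  rwa [update_layout_fresh] at h

theorem computes_dec_fresh :
    (dec freshTape).Computes (layout e s q (f + 1) v u) 2 (layout e s q f v u) := by
  have h := computes_dec (T := layout e s q (f + 1) v u) (i := freshTape) rfl
  rwa [update_layout_fresh] at h

theorem computes_inc_vertex :
    (inc vertexTape).Computes (layout e s q f v u) 2 (layout e s q f (v + 1) (u - 1)) := by
  have h := computes_inc (T := layout e s q f v u) (i := vertexTape) rfl
  rwa [List.tail_replicate, ← rowTape, update_layout_vertex] at h

theorem computes_pushUnary_query (t : ℕ) :
    (pushUnary queryTape t).Computes (layout e s q f v u) (2 * t + 2)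
      (layout e s (unary t ++ q) f v u) := by
  have h := computes_pushUnary (T := layout e s q f v u) (i := queryTape) rfl t
  rwa [update_layout_query] at h

theorem computes_emit_fresh :
    (emit freshTape queryTape).Computes (layout e s q f v u) (6 * f + 6)
      (layout e s (unary f ++ q) f v u) := by
  have h := computes_emit (T := layout e s q f v u) (i := freshTape) (j := queryTape) (r := [])
    (by decide) (by simp) rfl rfl
  rwa [update_layout_query] at h

theorem head?_replicate_false :
    (List.replicate u (some false)).head? ≠ some (some true) := by
  cases u <;> simp [List.replicate_succ]

theorem computes_emit_vertex :
    (emit vertexTape queryTape).Computes (layout e s q f v u) (6 * v + 6)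
      (layout e s (unary v ++ q) f v u) := by
  have h := computes_emit (T := layout e s q f v u) (i := vertexTape) (j := queryTape)
    (by decide) (head?_replicate_false u) rfl rfl
  rwa [update_layout_query] at h

end layout

/-- Move the head on tape `i` back to the beginning of a row. -/
def rewind (i : Fin 6) : TapeProgram 6 :=
  move i Turing.Dir.left ⨾ loop (scans i true) (put i (some false) Turing.Dir.left) ⨾
    move i Turing.Dir.right

theorem computes_rewind {T : Tapes 6} {i : Fin 6} {v u : ℕ} (h : T i = rowTape v u) :
    (rewind i).Computes T (3 * v + 3) (Function.update T i (rowTape 0 (v + u))) := by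
  have hloop : (loop (scans i true) (put i (some false) Turing.Dir.left)).Computes
      (Function.update T i ((rowTape v u).move Turing.Dir.left)) (v * 3 + 1)
      (Function.update T i ((rowTape 0 (v + u)).move Turing.Dir.left)) := by
    rw [add_comm v u]
    have h := computes_loop_transfer (c := scans i true) (p := put i (some false) Turing.Dir.left)
      (t := 2) (fun a b => Function.update T i ((rowTape a (u + b)).move Turing.Dir.left))
      (fun a b => ?_) (fun a b => ?_) (fun b => ?_) v
    · exact h
    · simp only [heads, scans, Function.update_self, rowTape, counterTape_succ]
      rfl
    · have h := computes_put (i := i) (a := some false) (D := Turing.Dir.left)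
        (T := Function.update T i ((rowTape (a + 1) (u + b)).move Turing.Dir.left))
        (X := (rowTape a (u + (b + 1))).move Turing.Dir.left)
        (by rw [Function.update_self, rowTape, counterTape_succ]; rfl)
      rwa [Function.update_idem] at h
    · simp only [heads, scans, Function.update_self, rowTape, counterTape_zero_move_left_head]
      rfl
  have h₁ := computes_move i Turing.Dir.left T
  have h₂ := computes_move i Turing.Dir.right
    (Function.update T i ((rowTape 0 (v + u)).move Turing.Dir.left))
  rw [h] at h₁
  rw [Function.update_idem, Function.update_self, Turing.Tape.move_left_right] at h₂
  exact (h₁.seq (hloop.seq h₂)).mono (by omega)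

variable {e s q : List Bool} {f v u : ℕ}

theorem computes_rewind_vertex :
    (rewind vertexTape).Computes (layout e s q f v u) (3 * v + 3) (layout e s q f 0 (v + u)) := by
  have h := computes_rewind (T := layout e s q f v u) (i := vertexTape) rfl
  rwa [update_layout_vertex] at h

/-- Read the number of vertices. -/
def readHeader : TapeProgram 6 :=
  loop (scans inputTape true) (pop inputTape ⨾ inc freshTape ⨾ inc vertexTape) ⨾ pop inputTape ⨾
    rewind vertexTape

theorem computes_readHeader (n : ℕ) :
    readHeader.Computes (layout e (unary n ++ s) q 0 0 0) (10 * n + 6) (layout e s q n 0 n) := by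
  have hloop := computes_loop_transfer (c := scans inputTape true)
    (fun a b => layout e (unary a ++ s) q b b 0) (fun a b => rfl)
    (fun a b => (computes_pop_input e (unary a ++ s) q b b 0 true).seq
      ((computes_inc_fresh ..).seq (computes_inc_vertex ..))) (fun b => rfl) n
  exact (hloop.seq ((computes_pop_input ..).seq computes_rewind_vertex)).mono (by omega)

/-- Read one symbol of a row. -/
def advance : TapeProgram 6 := pop inputTape ⨾ inc vertexTape

theorem computes_advance (b : Bool) :
    advance.Computes (layout e (b :: s) q f v (u + 1)) 4 (layout e s q f (v + 1) u) :=
  (computes_pop_input ..).seq (computes_inc_vertex ..)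

/-- The test whether the row is not over. -/
abbrev inRow (h : Fin 6 → Option Bool) : Bool := scans vertexTape false h

/-- Skip the rest of a row. -/
def skipRow : TapeProgram 6 := loop inRow advance

theorem computes_skipRow (bs : List Bool) (v : ℕ) :
    skipRow.Computes (layout e (bs ++ s) q f v bs.length) (5 * bs.length + 1)
      (layout e s q f (v + bs.length) 0) := by
  induction bs generalizing v with
  | nil => exact computes_loop_of_false _ rfl
  | cons b bs ih =>
    have h := ih (v + 1)
    rw [add_assoc, add_comm 1 bs.length] at h
    exact (computes_loop_of_true rfl (computes_advance b) h).mono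
      (by simp only [List.length_cons]; omega)

/-- Skip `0`s within a row. -/
def seekOne : TapeProgram 6 := loop (fun h => inRow h && scans inputTape false h) advance

theorem computes_seekOne (bs : List Bool) (v : ℕ) : ∃ v' bs',
    seekOne.Computes (layout e (bs ++ s) q f v bs.length) (5 * bs.length + 1)
      (layout e (bs' ++ s) q f v' bs'.length) ∧
    bs'.findIdxs id v' = bs.findIdxs id v ∧ v' + bs'.length = v + bs.length ∧
    bs'.head? ≠ some false := by
  induction bs generalizing v with
  | nil => exact ⟨v, [], computes_loop_of_false _ rfl, rfl, rfl, by simp⟩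
  | cons b bs ih =>
    cases b with
    | true =>
      exact ⟨v, true :: bs, (computes_loop_of_false _ rfl).mono (by omega), rfl, rfl, by simp⟩
    | false =>
      obtain ⟨v', bs', h, hidx, hlen, hhead⟩ := ih (v + 1)
      refine ⟨v', bs', (computes_loop_of_true rfl (computes_advance false) h).mono ?_,
        by simpa using hidx, ?_, hhead⟩ <;> simp only [List.length_cons] <;> omega

/-- Push the next vertex of the current row, or the fresh variable if there is none. -/
def fillSlot : TapeProgram 6 :=
  seekOne ⨾ ite inRow (emit vertexTape queryTape ⨾ advance) (emit freshTape queryTape)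

theorem computes_fillSlot {B : ℕ} (bs : List Bool) (hf : f ≤ B) (hv : v + bs.length ≤ B) :
    ∃ v' bs', fillSlot.Computes (layout e (bs ++ s) q f v bs.length) (11 * B + 12)
      (layout e (bs' ++ s) (unary ((bs.findIdxs id v).head?.getD f) ++ q) f v' bs'.length) ∧
    bs'.findIdxs id v' = (bs.findIdxs id v).tail ∧ v' + bs'.length = v + bs.length := by
  obtain ⟨v', bs', h, hidx, hlen, hhead⟩ :=
    computes_seekOne (e := e) (s := s) (q := q) (f := f) bs v
  rw [← hidx]
  match bs' with
  | [] =>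
    exact ⟨v', [], (h.seq (computes_ite_of_false _ rfl (computes_emit_fresh ..))).mono (by omega),
      rfl, hlen⟩
  | true :: bs' =>
    rw [List.findIdxs_cons]
    rw [List.length_cons] at hlen h
    exact ⟨v' + 1, bs', (h.seq (computes_ite_of_true _ rfl
      ((computes_emit_vertex ..).seq (computes_advance true)))).mono (by omega), rfl, by omega⟩
  | false :: bs' => exact absurd rfl hhead

/-- Push the scope of a gadget, decrementing the counter of variables. -/
def pushScope : {r : ℕ} → (Fin r → Bool) → TapeProgram 6
  | 0, _ => skip
  | r + 1, slot => dec freshTape ⨾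
      (if slot (Fin.last r) then fillSlot else emit freshTape queryTape) ⨾ pushScope (Fin.init slot)

theorem computes_pushScope {B r : ℕ} (slot : Fin r → Bool) (hf : f + r ≤ B) (bs q : List Bool)
    (hv : v + bs.length ≤ B) : ∃ v' bs',
    (pushScope slot).Computes (layout e (bs ++ s) q (f + r) v bs.length) (r * (11 * B + 14) + 1)
      (layout e (bs' ++ s) (scopeCode slot f (bs.findIdxs id v) ++ q) f v' bs'.length) ∧
    v' + bs'.length = v + bs.length := by
  induction r generalizing bs q v with
  | zero => exact ⟨v, bs, (computes_skip _).mono (by omega), rfl⟩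
  | succ r ih =>
    obtain ⟨v₁, bs₁, h₁, hidx, hlen₁⟩ : ∃ v₁ bs₁,
        (if slot (Fin.last r) then fillSlot else emit freshTape queryTape).Computes
          (layout e (bs ++ s) q (f + r) v bs.length) (11 * B + 12)
          (layout e (bs₁ ++ s) (unary ((if slot (Fin.last r) then (bs.findIdxs id v).head?
            else none).getD (f + r)) ++ q) (f + r) v₁ bs₁.length) ∧
        bs₁.findIdxs id v₁ =
          (if slot (Fin.last r) then (bs.findIdxs id v).tail else bs.findIdxs id v) ∧
        v₁ + bs₁.length = v + bs.length := by
      split_ifs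
      · exact computes_fillSlot bs (by omega) hv
      · exact ⟨v, bs, (computes_emit_fresh ..).mono (by omega), rfl, rfl⟩
    obtain ⟨v', bs', h₂, hlen₂⟩ := ih (Fin.init slot) (by omega) bs₁ _ (hlen₁.trans_le hv)
    rw [hidx] at h₂
    refine ⟨v', bs', ?_, hlen₂.trans hlen₁⟩
    rw [scopeCode_succ, List.append_assoc, add_one_mul]
    exact ((computes_dec_fresh ..).seq (h₁.seq h₂)).mono (by omega)

/-- Push the pins of the next fresh variables, incrementing the counter of variables. -/
def pushPins : {r : ℕ} → (Fin r → Bool) → TapeProgram 6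
  | 0, _ => skip
  | r + 1, val => pushPins (Fin.init val) ⨾ emit freshTape queryTape ⨾
      pushUnary queryTape (pinName (val (Fin.last r))) ⨾ inc freshTape

theorem computes_pushPins {B r : ℕ} (val : Fin r → Bool) (hf : f + r ≤ B) :
    (pushPins val).Computes (layout e s q f v u) (r * (6 * B + 14) + 1)
      (layout e s (pinsCode val f ++ q) (f + r) v u) := by
  induction r with
  | zero => exact (computes_skip _).mono (by omega)
  | succ r ih =>
    have hpin := pinName_le (val (Fin.last r))
    rw [pinsCode_succ, List.append_assoc, List.append_assoc, add_one_mul]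
    exact ((ih (Fin.init val) (by omega)).seq ((computes_emit_fresh ..).seq
      ((computes_pushUnary_query ..).seq (computes_inc_fresh ..)))).mono (by omega)

/-- Replace one hyper-edge by its gadget. -/
def handleRow {r : ℕ} (slot val : Fin r → Bool) : TapeProgram 6 :=
  pop inputTape ⨾ pushPins val ⨾ pushScope slot ⨾ pushUnary queryTape 0 ⨾ incs freshTape r ⨾
    skipRow ⨾ rewind vertexTape

theorem computes_handleRow {B r : ℕ} (slot val : Fin r → Bool) (bs : List Bool)
    (hf : f + r ≤ B) (hn : bs.length ≤ B) :
    (handleRow slot val).Computes (layout e (true :: bs ++ s) q f 0 bs.length)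
      ((r + 1) * (17 * B + 30))
      (layout e s (gadgetCode slot val f (bs.findIdxs id) ++ q) (f + r) 0 bs.length) := by
  obtain ⟨v, bs', hscope, hlen⟩ := computes_pushScope (e := e) (s := s) (v := 0) slot hf bs
    (pinsCode val f ++ q) (by omega)
  have hskip := computes_skipRow (e := e) (s := s) (f := f + r)
    (q := gadgetCode slot val f (bs.findIdxs id) ++ q) bs' v
  rw [zero_add] at hlen
  rw [hlen] at hskip
  rw [gadgetCode, List.append_assoc, List.append_assoc] at hskip ⊢
  have h := (computes_pop_input e (bs ++ s) q f 0 bs.length true).seq <|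
    (computes_pushPins val hf).seq <| hscope.seq <| (computes_pushUnary_query _ _ _ _ _ _ 0).seq <|
    (computes_incs_fresh _ _ _ _ _ _ r).seq <| hskip.seq computes_rewind_vertex
  refine h.mono ?_
  have : r * (6 * B + 14) + r * (11 * B + 14) + 2 * r = r * (17 * B + 30) := by ring
  rw [add_one_mul]
  omega

/-- Replace all hyper-edges by their gadgets. -/
def handleRows {r : ℕ} (slot val : Fin r → Bool) : TapeProgram 6 :=
  loop (scans inputTape true) (handleRow slot val)

theorem computes_handleRows {B n m r : ℕ} (slot val : Fin r → Bool) (hn : n ≤ B)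
    (rows : Fin m → List Bool) (hrows : ∀ i, (rows i).length = n) (hf : f + m * r ≤ B) :
    (handleRows slot val).Computes
      (layout e ((List.ofFn rows).flatMap (List.cons true)) q f 0 n)
      (m * ((r + 1) * (17 * B + 30) + 1) + 1)
      (layout e [] (gadgetsCode slot val f rows ++ q) (f + m * r) 0 n) := by
  induction m generalizing f q with
  | zero =>
    rw [zero_mul, zero_mul, add_zero, zero_add]
    exact computes_loop_of_false _ rfl
  | succ m ih =>
    rw [add_one_mul, add_comm _ r, ← add_assoc] at hf
    obtain rfl := hrows 0
    have hrow := computes_handleRow (e := e) (q := q) (f := f) (B := B)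
      (s := (List.ofFn (Fin.tail rows)).flatMap (List.cons true)) slot val (rows 0) (by omega) hn
    have hrest := ih (q := gadgetCode slot val f ((rows 0).findIdxs id) ++ q)
      (Fin.tail rows) (fun i => hrows i.succ) hf
    have h := computes_loop_of_true (c := scans inputTape true) rfl hrow hrest
    rw [List.ofFn_succ, gadgetsCode_succ, List.append_assoc, add_one_mul, add_one_mul m r,
      add_comm (m * r) r, ← add_assoc f r]
    exact h.mono (by omega)

/-- The reduction: the number of variables is written last, in front of the constraints. -/
def reduction {r : ℕ} (slot val : Fin r → Bool) : TapeProgram 6 :=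
  readHeader ⨾ handleRows slot val ⨾ emit freshTape queryTape

theorem computes_reduction {n m r : ℕ} (slot val : Fin r → Bool) (e : List Bool)
    (rows : Fin m → List Bool) (hrows : ∀ i, (rows i).length = n) : ∃ T,
    (reduction slot val).Computes
      (initTapes 2 (unary n ++ (List.ofFn rows).flatMap (List.cons true)) e)
      ((n + m + 1) * ((r + 1) * (17 * ((r + 1) * (n + m)) + 40))) T ∧
    tapeString (T 2) = unary (n + m * r) ++ gadgetsCode slot val n rows ∧
    tapeString (T 1) = e := by
  set B := (r + 1) * (n + m) with hB
  have hB' : B = n + m * r + (n * r + m) := by rw [hB]; ring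
  have hhandle := computes_handleRows (e := e) (q := []) (B := B) (f := n) slot val (by omega) rows
    hrows (by omega)
  rw [List.append_nil] at hhandle
  rw [initTapes_eq_layout]
  refine ⟨_, ((computes_readHeader n).seq (hhandle.seq (computes_emit_fresh ..))).mono ?_,
    tapeString_stackTape _, tapeString_stringTape _⟩
  calc 10 * n + 6 + (m * ((r + 1) * (17 * B + 30) + 1) + 1 + (6 * (n + m * r) + 6))
      ≤ m * ((r + 1) * (17 * B + 40)) + (n + 1) * (1 * 40) := by nlinarith
    _ ≤ m * ((r + 1) * (17 * B + 40)) + (n + 1) * ((r + 1) * (17 * B + 40)) := by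
      gcongr <;> omega
    _ = (n + m + 1) * ((r + 1) * (17 * B + 40)) := by ring

end TapeProgram

/-! ### Gadgets for OR-conj and NAND-conj relations -/

/-- With the arguments outside the slots pinned according to `val`, the relation says that some
argument in a slot has the value `g`. Without slots nothing is required of the relation, as there
is no hyper-edge to be expressed by it. -/
structure IsGadget (R : BoolRel) (slot val : Fin R.arity → Bool) (g : Bool) : Prop where
  val_slot : ∀ j, slot j = true → val j = !g
  mem_rel : (∃ j, slot j = true) → ∀ a, (∀ j, slot j = false → a j = val j) →
    (a ∈ R.rel ↔ ∃ j, slot j = true ∧ a j = g)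

theorem exists_length_eq_foldr_max {α : Type*} (L : List (List α))
    (h : (L.map List.length).foldr max 0 ≠ 0) :
    ∃ c ∈ L, c.length = (L.map List.length).foldr max 0 := by
  induction L with
  | nil => exact absurd rfl h
  | cons c L ih =>
    rw [List.map_cons, List.foldr_cons] at h ⊢
    rcases le_total ((L.map List.length).foldr max 0) c.length with hle | hle
    · exact ⟨c, List.mem_cons_self, (max_eq_left hle).symm⟩
    · rw [max_eq_right hle] at h ⊢
      obtain ⟨c', hc', hl⟩ := ih h
      exact ⟨c', List.mem_cons_of_mem _ hc', hl⟩

namespace ConjFormula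

variable {r : ℕ} {φ : ConjFormula r} {c c' : List (Fin r)}

theorem Normalized.exists_mem_not_mem (h : φ.Normalized) (hc : c ∈ φ.clauses)
    (hc' : c' ∈ φ.clauses) (hne : c' ≠ c) : ∃ i ∈ c', i ∉ c := by
  have : Std.Symm fun c c' : List (Fin r) => ¬ c ⊆ c' ∧ ¬ c' ⊆ c := ⟨fun _ _ h => h.symm⟩
  have := (h.incomparable.forall hc' hc hne).1
  simpa [List.subset_def] using this

theorem Normalized.pin_unique (h : φ.Normalized) (hc : c ∈ φ.clauses) {i : Fin r}
    (h0 : (i, false) ∈ φ.pins) : (i, true) ∉ φ.pins := fun h1 => by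
  simp [h.consistent ⟨i, h0, h1⟩] at hc

/-- The values that isolate the clause `c` of `φ`, where `b` is the value that satisfies a clause:
the pins of `φ`, `b` on the arguments that `φ` does not pin, and `!b` on `c` itself, so that its
unused arguments have no effect. -/
def pinValue (φ : ConjFormula r) (c : List (Fin r)) (b : Bool) (j : Fin r) : Bool :=
  if j ∈ c then !b
  else if j ∈ φ.pins.map Prod.fst then decide ((j, true) ∈ φ.pins)
  else b

theorem pinValue_of_mem (φ : ConjFormula r) (b : Bool) {j : Fin r} (h : j ∈ c) :
    φ.pinValue c b j = !b := if_pos h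

theorem Normalized.pinValue_of_pin (h : φ.Normalized) (hc : c ∈ φ.clauses) (b : Bool)
    {p : Fin r × Bool} (hp : p ∈ φ.pins) : φ.pinValue c b p.1 = p.2 := by
  rw [pinValue, if_neg (h.pinned_not_mem p hp c hc), if_pos (List.mem_map_of_mem hp)]
  obtain ⟨i, b'⟩ := p
  cases b' with
  | true => exact decide_eq_true hp
  | false => exact decide_eq_false (h.pin_unique hc hp)

theorem Normalized.pinValue_of_not_mem (h : φ.Normalized) (hc' : c' ∈ φ.clauses) (b : Bool)
    {j : Fin r} (hj : j ∉ c) (hj' : j ∈ c') : φ.pinValue c b j = b := by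
  rw [pinValue, if_neg hj, if_neg]
  intro hm
  obtain ⟨p, hp, rfl⟩ := List.mem_map.1 hm
  exact h.pinned_not_mem p hp c' hc' hj'

theorem Normalized.holds_iff_of_pinValue (h : φ.Normalized) (hc : c ∈ φ.clauses) (b : Bool)
    {a : Fin r → Bool} (ha : ∀ j ∉ c, a j = φ.pinValue c b j) :
    ((∀ p ∈ φ.pins, a p.1 = p.2) ∧ ∀ c' ∈ φ.clauses, ∃ i ∈ c', a i = b) ↔ ∃ j ∈ c, a j = b := by
  refine ⟨fun hφ => hφ.2 c hc, fun hj => ⟨fun p hp => ?_, fun c' hc' => ?_⟩⟩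
  · rw [ha _ (h.pinned_not_mem p hp c hc), h.pinValue_of_pin hc b hp]
  · by_cases hne : c' = c
    · rwa [hne]
    · obtain ⟨i, hi, hic⟩ := h.exists_mem_not_mem hc hc' hne
      exact ⟨i, hi, by rw [ha i hic, h.pinValue_of_not_mem hc' b hic hi]⟩

theorem Normalized.exists_isGadget {R : BoolRel} {φ : ConjFormula R.arity} (h : φ.Normalized)
    {b : Bool} (hrel : ∀ a, a ∈ R.rel ↔
      (∀ p ∈ φ.pins, a p.1 = p.2) ∧ ∀ c ∈ φ.clauses, ∃ i ∈ c, a i = b) :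
    ∃ slot val g, IsGadget R slot val g ∧
      (Finset.univ.filter fun j => slot j = true).card = φ.width := by
  by_cases hw : φ.width = 0
  · exact ⟨fun _ => false, fun _ => b, b, ⟨by simp, by simp⟩, by simp [hw]⟩
  · obtain ⟨c, hc, hl⟩ := exists_length_eq_foldr_max φ.clauses hw
    refine ⟨fun j => decide (j ∈ c), φ.pinValue c b, b, ⟨?_, fun _ a ha => ?_⟩, ?_⟩
    · exact fun j hj => φ.pinValue_of_mem b (of_decide_eq_true hj)
    · simp only [decide_eq_true_eq, decide_eq_false_iff_not] at ha ⊢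
      exact (hrel a).trans (h.holds_iff_of_pinValue hc b ha)
    · rw [width, ← hl, ← List.toFinset_card_of_nodup (h.nodup c hc)]
      congr 1
      ext j
      simp

end ConjFormula

theorem exists_isGadget {R : BoolRel} {w : ℕ} (hR : R.IsORConjOfWidth w ∨ R.IsNANDConjOfWidth w) :
    ∃ slot val g, IsGadget R slot val g ∧
      (Finset.univ.filter fun j => slot j = true).card = w := by
  rcases hR with ⟨φ, hφ, hrel, rfl⟩ | ⟨φ, hφ, hrel, rfl⟩
  · exact hφ.exists_isGadget (b := true) hrel
  · exact hφ.exists_isGadget (b := false) fun a => (hrel a).trans (by simp [ConjFormula.HoldsNAND])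

/-! ### The constraints of the reduction -/

section Constraint

variable (R : BoolRel) {X : Type}

/-- The pin of the variable `v` to the value `b`. -/
def pinConstraint (b : Bool) (v : X) : Constraint ([R] ++ pinLanguage) X :=
  ⟨⟨pinName b, by cases b <;> simp [pinName, pinLanguage]⟩, fun _ => v⟩

/-- The constraint `R(x₁, …, x_r)`. -/
def relConstraint (x : Fin R.arity → X) : Constraint ([R] ++ pinLanguage) X := ⟨⟨0, by simp⟩, x⟩

theorem constraintCode_pinConstraint {n : ℕ} (b : Bool) (v : Fin n) :
    constraintCode (pinConstraint R b v) = unary (pinName b) ++ unary v := by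
  cases b <;> exact congrArg _ (List.append_nil _)

theorem constraintCode_relConstraint {n : ℕ} (x : Fin R.arity → Fin n) :
    constraintCode (relConstraint R x) =
      unary 0 ++ (List.ofFn fun j => (x j : ℕ)).flatMap unary := rfl

variable {R}

theorem pinConstraint_right_injective {b b' : Bool} {v v' : X}
    (h : pinConstraint R b v = pinConstraint R b' v') : v = v' := by
  have hrange (b : Bool) (v : X) : Set.range (pinConstraint R b v).2 = {v} := by
    cases b <;> exact Set.range_const (ι := Fin 1)
  have hsingleton := congrArg (fun c => Set.range c.2) h
  rwa [hrange, hrange, Set.singleton_eq_singleton_iff] at hsingleton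

theorem relConstraint_injective :
    Function.Injective (relConstraint R : (Fin R.arity → X) → Constraint _ X) :=
  fun _ _ h => eq_of_heq (Sigma.mk.inj h).2

theorem relConstraint_ne_pinConstraint (x : Fin R.arity → X) (b : Bool) (v : X) :
    relConstraint R x ≠ pinConstraint R b v := fun h => by
  have : 0 = pinName b := congrArg (fun c => (c.1 : ℕ)) h
  cases b <;> exact absurd this (by decide)

theorem pinConstraint_satisfied (b : Bool) (v : X) (σ : X → Bool) :
    (fun j => σ ((pinConstraint R b v).2 j)) ∈
      (([R] ++ pinLanguage).get (pinConstraint R b v).1).rel ↔ σ v = b := by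
  cases b <;> exact Iff.rfl

theorem card_pinConstraint [DecidableEq X] (b : Bool) (v y : X) :
    (Finset.univ.filter fun j => (pinConstraint R b v).2 j = y).card = if v = y then 1 else 0 := by
  change (Finset.univ.filter fun _ => v = y).card = _
  rw [Finset.filter_const, apply_ite Finset.card, Finset.card_empty]
  cases b <;> rfl

end Constraint

/-! ### The instance of a hypergraph -/

section gadgetInstance

variable {R : BoolRel} {slot val : Fin R.arity → Bool} {g : Bool} {V ι X : Type} [LinearOrder V]
  {edge : ι → Finset V}

/-- The scope of the gadget of a hyper-edge: a slot may hold a vertex of the hyper-edge, all other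
arguments are fresh variables. -/
def gadgetScope {r : ℕ} (slot : Fin r → Bool) (edge : ι → Finset V) (i : ι) (j : Fin r) :
    V ⊕ ι × Fin r :=
  (fill slot (edge i).sort j).elim (.inr (i, j)) .inl

/-- The constraints that express a hypergraph: `none` stands for the constraint `R` of a hyper-edge
and `some j` for the pin of its `j`-th fresh variable, whether or not that variable is used. The
variables are named by `x`. -/
def gadgetConstraint (slot val : Fin R.arity → Bool) (edge : ι → Finset V)
    (x : V ⊕ ι × Fin R.arity ≃ X) : ι × Option (Fin R.arity) → Constraint ([R] ++ pinLanguage) X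
  | (i, none) => relConstraint R fun j => x (gadgetScope slot edge i j)
  | (i, some j) => pinConstraint R (val j) (x (.inr (i, j)))

/-- The instance that expresses the hypergraph with hyper-edges `edge i`. -/
def gadgetInstance [Fintype ι] [DecidableEq X] (slot val : Fin R.arity → Bool)
    (edge : ι → Finset V) (x : V ⊕ ι × Fin R.arity ≃ X) : CSPInstance ([R] ++ pinLanguage) X :=
  ⟨Finset.univ.image (gadgetConstraint slot val edge x)⟩

section gadgetScope

variable {r : ℕ} {slot : Fin r → Bool} {i i' : ι} {j j' : Fin r} {v : V}

theorem gadgetScope_eq_inl_iff :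
    gadgetScope slot edge i j = .inl v ↔ fill slot (edge i).sort j = some v := by
  rw [gadgetScope]
  cases fill slot (edge i).sort j <;> simp

theorem eq_of_gadgetScope_eq_inr (h : gadgetScope slot edge i j = .inr (i', j')) :
    (i, j) = (i', j') := by
  rw [gadgetScope] at h
  cases hfill : fill slot (edge i).sort j with
  | none => rwa [hfill, Option.elim_none, Sum.inr.injEq] at h
  | some v => simp [hfill] at h

theorem of_gadgetScope_eq_inl (h : gadgetScope slot edge i j = .inl v) :
    slot j = true ∧ v ∈ edge i := by
  simpa using of_fill_eq_some (gadgetScope_eq_inl_iff.1 h)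

theorem gadgetScope_injective (i : ι) : Function.Injective (gadgetScope slot edge i) := by
  intro j j' h
  cases hj : gadgetScope slot edge i j with
  | inl v =>
    exact eq_of_fill_eq_some (Finset.sort_nodup ..) (gadgetScope_eq_inl_iff.1 hj)
      (gadgetScope_eq_inl_iff.1 (h ▸ hj))
  | inr p =>
    exact congrArg Prod.snd ((eq_of_gadgetScope_eq_inr hj).trans
      (eq_of_gadgetScope_eq_inr (h ▸ hj)).symm)

theorem mem_edge_iff_exists_gadgetScope
    (hcard : (edge i).card ≤ (Finset.univ.filter fun j => slot j = true).card) :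
    v ∈ edge i ↔ ∃ j, gadgetScope slot edge i j = .inl v := by
  refine ⟨fun hv => ?_, fun ⟨j, hj⟩ => (of_gadgetScope_eq_inl hj).2⟩
  simp only [gadgetScope_eq_inl_iff]
  exact exists_fill_eq_some (by rwa [Finset.length_sort]) ((Finset.mem_sort _).2 hv)

end gadgetScope

variable {x : V ⊕ ι × Fin R.arity ≃ X}

theorem gadgetConstraint_injective (hedge : Function.Injective edge)
    (hcard : ∀ i, (edge i).card ≤ (Finset.univ.filter fun j => slot j = true).card) :
    Function.Injective (gadgetConstraint slot val edge x) := by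
  rintro ⟨i, _ | j⟩ ⟨i', _ | j'⟩ h
  · have hscope (j) : gadgetScope slot edge i j = gadgetScope slot edge i' j :=
      x.injective (congrFun (relConstraint_injective h) j)
    have : edge i = edge i' := by
      ext v
      simp only [mem_edge_iff_exists_gadgetScope (hcard _), hscope]
    rw [hedge this]
  · exact absurd h (relConstraint_ne_pinConstraint _ _ _)
  · exact absurd h.symm (relConstraint_ne_pinConstraint _ _ _)
  · have hij := x.injective (pinConstraint_right_injective h)
    simp only [Sum.inr.injEq, Prod.mk.injEq] at hij
    rw [hij.1, hij.2]

/-! ### Solutions -/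

theorem gadgetScope_mem_rel_iff (hg : IsGadget R slot val g) {i : ι} (hne : (edge i).Nonempty)
    (hcard : (edge i).card ≤ (Finset.univ.filter fun j => slot j = true).card) {σ : X → Bool}
    (hpin : ∀ p : ι × Fin R.arity, σ (x (.inr p)) = val p.2) :
    (fun j => σ (x (gadgetScope slot edge i j))) ∈ R.rel ↔ ∃ v ∈ edge i, σ (x (.inl v)) = g := by
  have hslot : ∃ j, slot j = true :=
    hne.elim fun v hv => ((mem_edge_iff_exists_gadgetScope hcard).1 hv).imp
      fun j hj => (of_gadgetScope_eq_inl hj).1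
  have hfresh {j p} (h : gadgetScope slot edge i j = .inr p) :
      σ (x (gadgetScope slot edge i j)) = val j := by
    rw [h, hpin, ← congrArg Prod.snd (eq_of_gadgetScope_eq_inr h)]
  rw [hg.mem_rel hslot]
  · constructor
    · rintro ⟨j, hj, hσ⟩
      cases h : gadgetScope slot edge i j with
      | inl v => exact ⟨v, (of_gadgetScope_eq_inl h).2, h ▸ hσ⟩
      | inr p =>
        rw [hfresh h, hg.val_slot j hj] at hσ
        exact absurd hσ (Bool.not_ne_self g)
    · rintro ⟨v, hv, hσ⟩
      obtain ⟨j, hj⟩ := (mem_edge_iff_exists_gadgetScope hcard).1 hv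
      exact ⟨j, (of_gadgetScope_eq_inl hj).1, hj ▸ hσ⟩
  · intro j hj
    cases h : gadgetScope slot edge i j with
    | inl v => exact absurd (of_gadgetScope_eq_inl h).1 (by rw [hj]; exact Bool.false_ne_true)
    | inr p => rw [← h, hfresh h]

/-- The bijection between the sets of vertices and the assignments that respect the pins: a vertex
belongs to the set if its value is not `g`. -/
def assignmentEquiv [Fintype V] (val : Fin R.arity → Bool) (g : Bool)
    (x : V ⊕ ι × Fin R.arity ≃ X) :
    Finset V ≃ {σ : X → Bool // ∀ p : ι × Fin R.arity, σ (x (.inr p)) = val p.2} where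
  toFun S := ⟨fun y => (x.symm y).elim (fun v => if v ∈ S then !g else g) fun p => val p.2, by simp⟩
  invFun σ := Finset.univ.filter fun v => σ.1 (x (.inl v)) ≠ g
  left_inv S := by
    ext v
    by_cases hv : v ∈ S <;> simp [hv]
  right_inv σ := by
    ext y
    obtain ⟨v | p, rfl⟩ := x.surjective y
    · by_cases hv : σ.1 (x (.inl v)) = g
      · simp [hv]
      · simp [Bool.eq_not_of_ne hv]
    · simp [σ.2 p]

theorem assignmentEquiv_apply_inl_eq_iff [Fintype V] {S : Finset V} {v : V} :
    (assignmentEquiv val g x S).1 (x (.inl v)) = g ↔ v ∉ S := by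
  by_cases hv : v ∈ S <;> simp [assignmentEquiv, hv]

variable [Fintype ι] [DecidableEq X]

theorem gadgetInstance_satisfies_iff_rel {σ : X → Bool} :
    (gadgetInstance slot val edge x).Satisfies σ ↔
      (∀ p : ι × Fin R.arity, σ (x (.inr p)) = val p.2) ∧
        ∀ i, (fun j => σ (x (gadgetScope slot edge i j))) ∈ R.rel := by
  simp only [CSPInstance.Satisfies, gadgetInstance, Finset.forall_mem_image, Finset.mem_univ,
    true_implies, Prod.forall, Option.forall]
  rw [forall_and, and_comm]
  exact and_congr (forall₂_congr fun _ _ => pinConstraint_satisfied ..) Iff.rfl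

theorem gadgetInstance_satisfies_iff (hg : IsGadget R slot val g) (hne : ∀ i, (edge i).Nonempty)
    (hcard : ∀ i, (edge i).card ≤ (Finset.univ.filter fun j => slot j = true).card)
    {σ : X → Bool} :
    (gadgetInstance slot val edge x).Satisfies σ ↔
      (∀ p : ι × Fin R.arity, σ (x (.inr p)) = val p.2) ∧
        ∀ i, ∃ v ∈ edge i, σ (x (.inl v)) = g := by
  rw [gadgetInstance_satisfies_iff_rel, and_congr_right_iff]
  exact fun hpin => forall_congr' fun i => gadgetScope_mem_rel_iff hg (hne i) (hcard i) hpin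

theorem card_satisfies_gadgetInstance [Finite V] (hg : IsGadget R slot val g)
    (hne : ∀ i, (edge i).Nonempty)
    (hcard : ∀ i, (edge i).card ≤ (Finset.univ.filter fun j => slot j = true).card) :
    Nat.card {σ // (gadgetInstance slot val edge x).Satisfies σ} =
      Nat.card {S // ∀ i, ¬ edge i ⊆ S} := by
  have := Fintype.ofFinite V
  have hsat (S : Finset V) : (∀ i, ¬ edge i ⊆ S) ↔
      (gadgetInstance slot val edge x).Satisfies (assignmentEquiv val g x S).1 := by
    simp only [gadgetInstance_satisfies_iff hg hne hcard, (assignmentEquiv val g x S).2,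
      implies_true, true_and, assignmentEquiv_apply_inl_eq_iff, Finset.not_subset]
  refine Nat.card_congr (Equiv.trans ?_ ((assignmentEquiv val g x).subtypeEquiv
    (q := fun σ => (gadgetInstance slot val edge x).Satisfies σ.1) hsat).symm)
  exact (Equiv.subtypeSubtypeEquivSubtype
    fun h => ((gadgetInstance_satisfies_iff hg hne hcard).1 h).1).symm

/-! ### Degree -/

theorem gadgetInstance_occurrences [DecidableEq ι] (hedge : Function.Injective edge)
    (hcard : ∀ i, (edge i).card ≤ (Finset.univ.filter fun j => slot j = true).card)
    (y : V ⊕ ι × Fin R.arity) :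
    (gadgetInstance slot val edge x).occurrences (x y) =
      ∑ i, ((Finset.univ.filter fun j => gadgetScope slot edge i j = y).card +
        (Finset.univ.filter fun j => Sum.inr (i, j) = y).card) := by
  rw [CSPInstance.occurrences, gadgetInstance,
    Finset.sum_image (gadgetConstraint_injective hedge hcard).injOn, Fintype.sum_prod_type]
  refine Finset.sum_congr rfl fun i _ => ?_
  rw [Fintype.sum_option, Finset.card_filter (fun j => Sum.inr (i, j) = y)]
  congr 1
  · change (Finset.univ.filter fun j => x (gadgetScope slot edge i j) = x y).card = _
    simp only [x.injective.eq_iff]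
  · refine Finset.sum_congr rfl fun j _ => (card_pinConstraint ..).trans ?_
    simp only [x.injective.eq_iff]

theorem gadgetInstance_occurrences_inl_le (hedge : Function.Injective edge)
    (hcard : ∀ i, (edge i).card ≤ (Finset.univ.filter fun j => slot j = true).card) (v : V) :
    (gadgetInstance slot val edge x).occurrences (x (.inl v)) ≤
      (Finset.univ.filter fun i => v ∈ edge i).card := by
  classical
  rw [gadgetInstance_occurrences hedge hcard, Finset.card_filter]
  refine Finset.sum_le_sum fun i _ => ?_
  simp only [reduceCtorEq, Finset.filter_false, Finset.card_empty, add_zero]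
  split_ifs with hv
  · exact Finset.card_le_one.2 fun j hj j' hj' => gadgetScope_injective i
      ((Finset.mem_filter.1 hj).2.trans (Finset.mem_filter.1 hj').2.symm)
  · rw [Nat.le_zero, Finset.card_eq_zero]
    exact Finset.filter_false_of_mem fun j _ hj => hv (of_gadgetScope_eq_inl hj).2

theorem gadgetInstance_occurrences_inr_le (hedge : Function.Injective edge)
    (hcard : ∀ i, (edge i).card ≤ (Finset.univ.filter fun j => slot j = true).card)
    (p : ι × Fin R.arity) :
    (gadgetInstance slot val edge x).occurrences (x (.inr p)) ≤ 2 := by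
  classical
  rw [gadgetInstance_occurrences hedge hcard, Finset.sum_add_distrib]
  have hpin : ∑ i, (Finset.univ.filter fun j => (Sum.inr (i, j) : V ⊕ _) = .inr p).card = 1 := by
    simp only [Finset.card_filter, Sum.inr.injEq]
    rw [← Fintype.sum_prod_type' (f := fun i j => if (i, j) = p then 1 else 0)]
    simp
  have hscope : ∑ i, (Finset.univ.filter fun j => gadgetScope slot edge i j = .inr p).card ≤
      ∑ i, (Finset.univ.filter fun j => (Sum.inr (i, j) : V ⊕ _) = .inr p).card :=
    Finset.sum_le_sum fun i _ => Finset.card_le_card <| Finset.monotone_filter_right _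
      fun j _ hj => congrArg _ (eq_of_gadgetScope_eq_inr hj)
  omega

theorem gadgetInstance_degree_le [Fintype X] {d : ℕ} (hd : 2 ≤ d)
    (hedge : Function.Injective edge)
    (hcard : ∀ i, (edge i).card ≤ (Finset.univ.filter fun j => slot j = true).card)
    (hdeg : ∀ v, (Finset.univ.filter fun i => v ∈ edge i).card ≤ d) :
    (gadgetInstance slot val edge x).degree ≤ d := by
  refine Finset.sup_le fun y _ => ?_
  obtain ⟨v | p, rfl⟩ := x.surjective y
  · exact (gadgetInstance_occurrences_inl_le hedge hcard v).trans (hdeg v)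
  · exact (gadgetInstance_occurrences_inr_le hedge hcard p).trans hd

end gadgetInstance

/-! ### The encoding of the instance -/

theorem findIdxs_ofFn_mem {n : ℕ} (e : Finset (Fin n)) :
    (List.ofFn fun v => decide (v ∈ e)).findIdxs id = e.sort.map Fin.val := by
  have hsort : (e.sort.map Fin.val).Pairwise (· < ·) := List.pairwise_map.2 e.sortedLT_sort.pairwise
  refine List.pairwise_findIdxs.eq_of_mem_iff hsort fun i => ?_
  rw [List.mem_findIdxs_iff_exists_getElem_pos]
  simp [Fin.exists_iff]

theorem flatMap_product {α β γ : Type*} (l : List α) (l' : List β) (f : α × β → List γ) :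
    (l ×ˢ l').flatMap f = l.flatMap fun a => l'.flatMap fun b => f (a, b) :=
  List.flatMap_assoc.trans (by simp only [List.flatMap_map])

/-- The numbering of the variables: the vertices come first, then the fresh variables of one
hyper-edge after the other. -/
def variableNumber (n m r : ℕ) : Fin n ⊕ Fin m × Fin r ≃ Fin (n + m * r) :=
  (Equiv.sumCongr (Equiv.refl _) finProdFinEquiv).trans finSumFinEquiv

section encoding

variable {R : BoolRel} (slot val : Fin R.arity → Bool) {n m : ℕ} (edge : Fin m → Finset (Fin n))

theorem val_variableNumber_inr {r : ℕ} (i : Fin m) (j : Fin r) :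
    (variableNumber n m r (.inr (i, j)) : ℕ) = n + i * r + j := by
  change n + (j + r * i) = _
  ring

theorem val_variableNumber_gadgetScope (i : Fin m) (j : Fin R.arity) :
    (variableNumber n m R.arity (gadgetScope slot edge i j) : ℕ) =
      (fill slot ((edge i).sort.map Fin.val) j).getD (n + i * R.arity + j) := by
  rw [gadgetScope, fill_map]
  cases fill slot (edge i).sort j with
  | none => exact val_variableNumber_inr i j
  | some v => rfl

theorem gadgetCode_eq_flatMap (i : Fin m) :
    gadgetCode slot val (n + i * R.arity)
        ((List.ofFn fun v => decide (v ∈ edge i)).findIdxs id) =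
      (none :: (List.finRange R.arity).reverse.map some).flatMap fun o =>
        constraintCode (gadgetConstraint slot val edge (variableNumber n m R.arity) (i, o)) := by
  simp only [List.flatMap_cons, List.flatMap_map, gadgetConstraint, constraintCode_pinConstraint,
    constraintCode_relConstraint, val_variableNumber_gadgetScope, val_variableNumber_inr,
    findIdxs_ofFn_mem]
  rfl

theorem gadgetInstance_encodedBy (hedge : Function.Injective edge)
    (hcard : ∀ i, (edge i).card ≤ (Finset.univ.filter fun j => slot j = true).card) :
    (gadgetInstance slot val edge (variableNumber n m R.arity)).EncodedBy
      (unary (n + m * R.arity) ++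
        gadgetsCode slot val n fun i => List.ofFn fun v => decide (v ∈ edge i)) := by
  let order := (List.finRange m).reverse ×ˢ (none :: (List.finRange R.arity).reverse.map some)
  have hmem (c) : c ∈ order := by
    obtain ⟨i, _ | j⟩ := c <;> simp [order]
  have hnodup : order.Nodup :=
    (List.nodup_reverse.2 (List.nodup_finRange m)).product <| List.nodup_cons.2
      ⟨by simp, (List.nodup_reverse.2 (List.nodup_finRange _)).map (Option.some_injective _)⟩
  refine ⟨order.map (gadgetConstraint slot val edge (variableNumber n m R.arity)),
    hnodup.map (gadgetConstraint_injective hedge hcard), ?_, ?_⟩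
  · ext c
    simp [gadgetInstance, hmem]
  · simp only [cspCode, gadgetsCode, gadgetCode_eq_flatMap, order, List.flatMap_map,
      flatMap_product]

end encoding

theorem hypergraphCode_eq {n : ℕ} (L : List (Finset (Fin n))) :
    hypergraphCode n L = unary n ++
      (List.ofFn fun i => List.ofFn fun v => decide (v ∈ L.get i)).flatMap (List.cons true) := by
  have hrows := List.ofFn_getElem_eq_map L fun e => List.ofFn fun v => decide (v ∈ e)
  rw [hypergraphCode]
  simp only [List.get_eq_getElem, hrows, List.flatMap_map]
  rfl

theorem add_length_le_length_hypergraphCode {n : ℕ} (L : List (Finset (Fin n))) :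
    n + L.length ≤ (hypergraphCode n L).length := by
  rw [hypergraphCode, List.length_append, unary, List.length_append, List.length_replicate,
    List.length_flatMap]
  simp only [edgeCode, List.length_cons, List.length_ofFn, List.length_nil, List.map_const',
    List.sum_replicate, smul_eq_mul]
  have := Nat.le_mul_of_pos_right L.length n.add_one_pos
  omega

theorem apReducible_of_isGadget {R : BoolRel} {d : ℕ} (hd : 2 ≤ d) {slot val : Fin R.arity → Bool}
    {g : Bool} (hg : IsGadget R slot val g) :
    APReducible (countHIS (Finset.univ.filter fun j => slot j = true).card d)
      (countCSP d ([R] ++ pinLanguage)) := by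
  refine apReducible_of_computes (TapeProgram.reduction slot val)
    ((Polynomial.X + 1) * (Polynomial.C (R.arity + 1) *
      (Polynomial.C 17 * (Polynomial.C (R.arity + 1) * Polynomial.X) + Polynomial.C 40))) ?_
  rintro x ⟨⟨n, H⟩, hwidth, hdeg⟩ ⟨L, hL, hLH : _ = H.edges, rfl⟩
  have hedge : Function.Injective L.get := List.nodup_iff_injective_get.1 hL
  have hmem (e) : e ∈ H.edges ↔ ∃ i, L.get i = e := by
    rw [← hLH, List.mem_toFinset, List.mem_iff_get]
  have hcard (i) : (L.get i).card ≤ (Finset.univ.filter fun j => slot j = true).card :=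
    (Finset.le_sup (f := Finset.card) ((hmem _).2 ⟨i, rfl⟩)).trans_eq hwidth
  have hdegree (v) : (Finset.univ.filter fun i => v ∈ L.get i).card ≤ d := by
    refine le_trans ?_ ((Finset.le_sup (f := H.vertexDegree) (Finset.mem_univ v)).trans hdeg)
    refine Finset.card_le_card_of_injOn L.get (fun i hi => ?_) hedge.injOn
    exact Finset.mem_filter.2 ⟨(hmem _).2 ⟨i, rfl⟩, (Finset.mem_filter.1 hi).2⟩
  refine ⟨_, ⟨⟨_, gadgetInstance slot val L.get (variableNumber n L.length R.arity)⟩,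
    gadgetInstance_degree_le hd hedge hcard hdegree⟩,
    gadgetInstance_encodedBy slot val L.get hedge hcard, ?_, fun e => ?_⟩
  · refine (card_satisfies_gadgetInstance hg (fun i => H.nonempty _ ((hmem _).2 ⟨i, rfl⟩))
      hcard).trans ?_
    simp [countHIS, FinHypergraph.IsIndependent, hmem]
  · obtain ⟨T, hT, hquery, herror⟩ := TapeProgram.computes_reduction slot val e
      (fun i => List.ofFn fun v => decide (v ∈ L.get i)) fun _ => List.length_ofFn
    rw [← hypergraphCode_eq] at hT
    refine ⟨T, hT.mono ?_, hquery, herror⟩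
    have := add_length_le_length_hypergraphCode L
    simp only [Polynomial.eval_mul, Polynomial.eval_add, Polynomial.eval_X, Polynomial.eval_one,
      Polynomial.eval_C]
    gcongr

theorem proposition6p2 (R : BoolRel) (w d : ℕ) (hd : 2 ≤ d)
    (hR : R.IsORConjOfWidth w ∨ R.IsNANDConjOfWidth w) :
    APReducible (countHIS w d) (countCSP d ([R] ++ pinLanguage)) := by
  obtain ⟨slot, val, g, hg, rfl⟩ := exists_isGadget hR
  exact apReducible_of_isGadget hd hg
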